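/- Let $(C,\otimes,\mathbf 1)$ and $(D,\otimes,\mathbf 1)$ be closed symmetric monoidal categories having all (small) limits and colimits. Write $\mathrm{Comm}(C)$ for the category of commutative monoids in $C$, $A\text{-}\mathrm{Mod}$ for the category of modules over $A\in\mathrm{Comm}(C)$, and $\mathrm{Aff}_C=\mathrm{Comm}(C)^{op}$ (with $\mathrm{Spec}\,A$ the object corresponding to $A$). A morphism $A\to B$ in $\mathrm{Comm}(C)$ is *flat* if $-\otimes_AB:A\text{-}\mathrm{Mod}\to B\text{-}\mathrm{Mod}$ commutes with finite limits. A morphism $\mathrm{Spec}\,B\to\mathrm{Spec}\,A$ is a *Zariski open immersion* if $A\to B$ is a flat epimorphism such that $\mathrm{Hom}_{A/\mathrm{Comm}(C)}(B,-)$ commutes with filtered colimits. A family of Zariski open immersions $\{\mathrm{Spec}\,A_i\to\mathrm{Spec}\,A\}_{i\in I}$ is a *Zariski covering* if for some finite $J\subset I$ the functors $-\otimes_AA_j$ $(j\in J)$ are jointly conservative. These coverings generate the *Zariski topology* on $\mathrm{Aff}_C$, with category of sheaves of sets $\mathrm{Sh}(\mathrm{Aff}_C)$. The representable presheaves are sheaves,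 and $X\in\mathrm{Aff}_C$ is identified with the sheaf $h_X$ that it represents; such sheaves are called affine. For $X$ affine, a monomorphism of sheaves $F\to X$ is a *Zariski open of $X$* if $F$ is the image of $\coprod_iX_i\to X$ for a family of Zariski open immersions $X_i\to X$ in $\mathrm{Aff}_C$. A morphism $F\to G$ in $\mathrm{Sh}(\mathrm{Aff}_C)$ is a *Zariski open immersion* if for every affine $X$ and every $X\to G$, the projection $F\times_GX\to X$ is a monomorphism and a Zariski open of $X$. A sheaf $F$ is a *scheme relative to $C$* if there is an epimorphism of sheaves $\coprod_iX_i\to F$ with all $X_i$ affine and all $X_i\to F$ Zariski open immersions. $\mathrm{Sch}(C)\subset\mathrm{Sh}(\mathrm{Aff}_C)$ is the full subcategory of schemes. All these notions are used for $D$ as well. Let $f:C\to D$ be a (strong) symmetric monoidal functor with right adjoint $g:D\to C$. Then $g$ is lax symmetric monoidal and induces functors $\mathrm{Comm}(D)\to\mathrm{Comm}(C)$ and, for $A\in\mathrm{Comm}(C)$, $f(A)\text{-}\mathrm{Mod}\to A\text{-}\mathrm{Mod}$, again written $g$. Write $f:\mathrm{Aff}_C\to\mathrm{Aff}_D$ and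 $g:\mathrm{Aff}_D\to\mathrm{Aff}_C$ for the induced functors on affine schemes. Let $f^\sim_!:\mathrm{Sh}(\mathrm{Aff}_C)\to\mathrm{Sh}(\mathrm{Aff}_D)$ send a sheaf $F$ to the sheaf associated to the presheaf $f_!(F)=F\circ g$. Suppose that $g:D\to C$ is conservative and commutes with filtered colimits, and that for every flat morphism $A\to B$ in $\mathrm{Comm}(C)$ and every $N\in f(A)\text{-}\mathrm{Mod}$ the natural morphism of $B$-modules $$g(N)\otimes_AB\longrightarrow g\bigl(N\otimes_{f(A)}f(B)\bigr)$$ is an isomorphism. Then: 1. $f:\mathrm{Aff}_C\to\mathrm{Aff}_D$ is continuous for the Zariski topologies, i.e. precomposition with $f$ sends Zariski sheaves on $\mathrm{Aff}_D$ to Zariski sheaves on $\mathrm{Aff}_C$. 2. The functor $f^\sim_!$ sends schemes relative to $C$ to schemes relative to $D$, and hence induces a functor $\mathrm{Sch}(C)\to\mathrm{Sch}(D)$, $X\mapsto X\times_CD:=f^\sim_!(X)$. 3. For every affine scheme $X\in\mathrm{Aff}_C$, $f^\sim_!(X)$ is isomorphic, naturally in $X$, to the affine scheme $f(X)\in\mathrm{Aff}_D$.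 -/

import Mathlib

open CategoryTheory Limits MonoidalCategory

universe v u

set_option linter.unusedSectionVars false

namespace RelSch

noncomputable section

/-! ### Modules over commutative monoids and change of base -/

section Modules

variable {C : Type u} [Category.{v} C] [MonoidalCategory C] [SymmetricCategory C]

/-- The category `A-Mod` of modules over a commutative monoid `A` of `C`. -/
abbrev ModCat (A : CommMon C) := Mod C A.X

/-- The action `A ⊗ M ⟶ M` of a module. -/
def act {A : CommMon C} (M : ModCat A) : A.X ⊗ M.X ⟶ M.X :=
  ModObj.smul (M := A.X) (X := M.X)

lemma one_act {A : CommMon C} (M : ModCat A) :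
    MonObj.one ▷ M.X ≫ act M = (λ_ M.X).hom := ModObj.one_smul_self A.X M.X

lemma mul_act {A : CommMon C} (M : ModCat A) :
    MonObj.mul ▷ M.X ≫ act M = (α_ A.X A.X M.X).hom ≫ A.X ◁ act M ≫ act M :=
  ModObj.mul_smul_self A.X M.X

lemma act_hom {A : CommMon C} {M N : ModCat A} (h : M ⟶ N) :
    act M ≫ h.hom = A.X ◁ h.hom ≫ act N := IsModHom.smul_hom (A := A.X) (f := h.hom)

/-- A module from an object and an action satisfying the unit and associativity laws. -/
def mkMod {A : CommMon C} (X : C) (a : A.X ⊗ X ⟶ X)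
    (h1 : MonObj.one ▷ X ≫ a = (λ_ X).hom)
    (h2 : MonObj.mul ▷ X ≫ a = (α_ A.X A.X X).hom ≫ A.X ◁ a ≫ a) : ModCat A :=
  letI : ModObj A.X X := { smul := a, one_smul := h1, mul_smul := h2 }
  ⟨X⟩

/-- A morphism of modules from a morphism compatible with the actions. -/
def mkHom {A : CommMon C} {M N : ModCat A} (h : M.X ⟶ N.X)
    (w : act M ≫ h = A.X ◁ h ≫ act N) : M ⟶ N :=
  letI : IsModHom A.X h := ⟨w⟩
  ⟨h⟩

@[simp] lemma mkMod_X {A : CommMon C} (X : C) (a : A.X ⊗ X ⟶ X) (h1 h2) :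
    (mkMod X a h1 h2 : ModCat A).X = X := rfl

@[simp] lemma act_mkMod {A : CommMon C} (X : C) (a : A.X ⊗ X ⟶ X) (h1 h2) :
    act (mkMod X a h1 h2 : ModCat A) = a := rfl

@[simp] lemma mkHom_hom {A : CommMon C} {M N : ModCat A} (h : M.X ⟶ N.X) (w) :
    (mkHom h w : M ⟶ N).hom = h := rfl

variable {A B : CommMon C} (φ : A ⟶ B)

/-- The morphism of `C` underlying a morphism of commutative monoids. -/
def homX : A.X ⟶ B.X := φ.hom.hom

instance : IsMonHom (homX φ) := inferInstanceAs (IsMonHom φ.hom.hom)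

/-- Restriction of scalars `B-Mod ⥤ A-Mod` along a morphism `A ⟶ B`. -/
def restrictScalars : ModCat B ⥤ ModCat A := Mod.comap (homX φ)

@[simp] lemma restrictScalars_obj_X (N : ModCat B) : ((restrictScalars φ).obj N).X = N.X := rfl

@[simp] lemma restrictScalars_map_hom {N N' : ModCat B} (h : N ⟶ N') :
    ((restrictScalars φ).map h).hom = h.hom := rfl

lemma act_restrictScalars (N : ModCat B) :
    act ((restrictScalars φ).obj N) = homX φ ▷ N.X ≫ act N := rfl

section Extend

variable [HasCoequalizers C] [MonoidalClosed C]

/-- The map `(B ⊗ A) ⊗ M ⟶ B ⊗ M`, `(b ⊗ a) ⊗ m ↦ b φ(a) ⊗ m`. -/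
def extL (M : ModCat A) : (B.X ⊗ A.X) ⊗ M.X ⟶ B.X ⊗ M.X :=
  (B.X ◁ homX φ ≫ MonObj.mul) ▷ M.X

/-- The map `(B ⊗ A) ⊗ M ⟶ B ⊗ M`, `(b ⊗ a) ⊗ m ↦ b ⊗ a m`. -/
def extR (B : CommMon C) (M : ModCat A) : (B.X ⊗ A.X) ⊗ M.X ⟶ B.X ⊗ M.X :=
  (α_ B.X A.X M.X).hom ≫ B.X ◁ act M

/-- The object `B ⊗_A M` of `C`: the coequalizer of `extL` and `extR`. -/
def extObj (M : ModCat A) : C := coequalizer (extL φ M) (extR B M)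

/-- The projection `B ⊗ M ⟶ B ⊗_A M`. -/
def extπ (M : ModCat A) : B.X ⊗ M.X ⟶ extObj φ M := coequalizer.π _ _

lemma extπ_condition (M : ModCat A) : extL φ M ≫ extπ φ M = extR B M ≫ extπ φ M :=
  coequalizer.condition _ _

instance (M : ModCat A) : Epi (extπ φ M) := 
  inferInstanceAs (Epi (coequalizer.π (extL φ M) (extR B M)))

instance (Z : C) (M : ModCat A) : Epi (Z ◁ extπ φ M) :=
  inferInstanceAs (Epi ((tensorLeft Z).map (extπ φ M)))

/-- As `B ⊗ -` is a left adjoint, `B ⊗ (B ⊗_A M)` is a coequalizer, from which one may descend. -/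
lemma exists_desc (Z : C) (M : ModCat A) {W : C} (h : Z ⊗ (B.X ⊗ M.X) ⟶ W)
    (w : Z ◁ extL φ M ≫ h = Z ◁ extR B M ≫ h) :
    ∃ k : Z ⊗ extObj φ M ⟶ W, Z ◁ extπ φ M ≫ k = h := by
  exact ⟨_, id_tensor_π_preserves_coequalizer_inv_desc (extL φ M) (extR B M) h w⟩

lemma extAct_aux (M : ModCat A) :
    B.X ◁ extL φ M ≫ ((α_ B.X B.X M.X).inv ≫ MonObj.mul ▷ M.X ≫ extπ φ M) =
      B.X ◁ extR B M ≫ ((α_ B.X B.X M.X).inv ≫ MonObj.mul ▷ M.X ≫ extπ φ M) := by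
  have h1 : B.X ◁ extL φ M ≫ (α_ B.X B.X M.X).inv ≫ MonObj.mul ▷ M.X =
      (α_ B.X (B.X ⊗ A.X) M.X).inv ≫ (α_ B.X B.X A.X).inv ▷ M.X ≫
        (MonObj.mul ▷ A.X) ▷ M.X ≫ extL φ M := by
    have h : (α_ B.X B.X A.X).inv ≫ MonObj.mul ▷ A.X ≫ B.X ◁ homX φ ≫ MonObj.mul =
        B.X ◁ B.X ◁ homX φ ≫ B.X ◁ MonObj.mul ≫ MonObj.mul := by
      rw [← whisker_exchange_assoc, MonObj.mul_assoc]
      simp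
    simp only [extL, ← comp_whiskerRight, h]
    simp
  have h2 : B.X ◁ extR B M ≫ (α_ B.X B.X M.X).inv ≫ MonObj.mul ▷ M.X =
      (α_ B.X (B.X ⊗ A.X) M.X).inv ≫ (α_ B.X B.X A.X).inv ▷ M.X ≫
        (MonObj.mul ▷ A.X) ▷ M.X ≫ extR B M := by
    simp only [extR, MonoidalCategory.whiskerLeft_comp, Category.assoc,
      associator_naturality_left_assoc, ← whisker_exchange, tensor_whiskerLeft]
    simp
  rw [reassoc_of% h1, reassoc_of% h2, extπ_condition]

/-- The action `B ⊗ (B ⊗_A M) ⟶ B ⊗_A M`, `b ⊗ (b' ⊗ m) ↦ b b' ⊗ m`. -/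
def extAct (M : ModCat A) : B.X ⊗ extObj φ M ⟶ extObj φ M :=
  (exists_desc φ B.X M _ (extAct_aux φ M)).choose

lemma extπ_extAct (M : ModCat A) : B.X ◁ extπ φ M ≫ extAct φ M =
    (α_ B.X B.X M.X).inv ≫ MonObj.mul ▷ M.X ≫ extπ φ M :=
  (exists_desc φ B.X M _ (extAct_aux φ M)).choose_spec

/-- The `B`-module `B ⊗_A M`. -/
def extMod (M : ModCat A) : ModCat B :=
  mkMod (extObj φ M) (extAct φ M)
    (by
      rw [← cancel_epi (𝟙_ C ◁ extπ φ M), whisker_exchange_assoc, extπ_extAct,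
        associator_inv_naturality_left_assoc, ← comp_whiskerRight_assoc, MonObj.one_mul]
      simp)
    (by
      rw [← cancel_epi ((B.X ⊗ B.X) ◁ extπ φ M), whisker_exchange_assoc, extπ_extAct,
        associator_inv_naturality_left_assoc, ← comp_whiskerRight_assoc, MonObj.mul_assoc,
        associator_naturality_right_assoc, ← MonoidalCategory.whiskerLeft_comp_assoc, extπ_extAct]
      simp [extπ_extAct])

/-- The morphism of `C` underlying a `B`-linear map `B ⊗_A M ⟶ N`. -/
def extHom {M : ModCat A} {N : ModCat B} (h : extMod φ M ⟶ N) : extObj φ M ⟶ N.X := h.hom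

lemma extAct_extHom {M : ModCat A} {N : ModCat B} (h : extMod φ M ⟶ N) :
    extAct φ M ≫ extHom φ h = B.X ◁ extHom φ h ≫ act N :=
  act_hom h

lemma whiskerRight_extπ (M : ModCat A) :
    homX φ ▷ M.X ≫ extπ φ M =
      act M ≫ (λ_ M.X).inv ≫ MonObj.one ▷ M.X ≫ extπ φ M := by
  have h1 : homX φ ▷ M.X = (λ_ (A.X ⊗ M.X)).inv ≫ (α_ _ _ _).inv ≫
      (MonObj.one ▷ A.X) ▷ M.X ≫ extL φ M := by
    have h : (λ_ A.X).inv ≫ MonObj.one ▷ A.X ≫ B.X ◁ homX φ ≫ MonObj.mul = homX φ := by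
      rw [← whisker_exchange_assoc, MonObj.one_mul]
      simp
    rw [extL, ← comp_whiskerRight]
    nth_rw 1 [← h]
    simp
  have h2 : act M ≫ (λ_ M.X).inv ≫ MonObj.one ▷ M.X = (λ_ (A.X ⊗ M.X)).inv ≫ (α_ _ _ _).inv ≫
      (MonObj.one ▷ A.X) ▷ M.X ≫ extR B M := by
    simp only [extR, associator_naturality_left_assoc, ← whisker_exchange]
    simp
  rw [h1, reassoc_of% h2]
  simp only [Category.assoc, extπ_condition]

lemma whiskerLeft_one_extAct (M : ModCat A) :
    B.X ◁ ((λ_ M.X).inv ≫ MonObj.one ▷ M.X ≫ extπ φ M) ≫ extAct φ M = extπ φ M := by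
  simp only [MonoidalCategory.whiskerLeft_comp, Category.assoc, extπ_extAct]
  rw [associator_inv_naturality_middle_assoc, ← comp_whiskerRight_assoc, MonObj.mul_one]
  simp

/-- The morphism of `C` underlying an `A`-linear map `M ⟶ N` with `N` a `B`-module. -/
def resHom {M : ModCat A} {N : ModCat B} (k : M ⟶ (restrictScalars φ).obj N) : M.X ⟶ N.X := k.hom

lemma act_resHom {M : ModCat A} {N : ModCat B} (k : M ⟶ (restrictScalars φ).obj N) :
    act M ≫ resHom φ k = A.X ◁ resHom φ k ≫ homX φ ▷ N.X ≫ act N :=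
  act_hom k

/-- The map `B ⊗_A M ⟶ N`, `b ⊗ m ↦ b k(m)`. -/
def extDesc {M : ModCat A} {N : ModCat B} (k : M ⟶ (restrictScalars φ).obj N) :
    extObj φ M ⟶ N.X :=
  coequalizer.desc (B.X ◁ resHom φ k ≫ act N) (by
    simp only [extL, extR, Category.assoc, ← MonoidalCategory.whiskerLeft_comp_assoc, act_resHom]
    rw [← whisker_exchange_assoc, comp_whiskerRight_assoc, mul_act]
    simp)

lemma extπ_extDesc {M : ModCat A} {N : ModCat B} (k : M ⟶ (restrictScalars φ).obj N) :
    extπ φ M ≫ extDesc φ k = B.X ◁ resHom φ k ≫ act N :=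
  coequalizer.π_desc _ _

/-- The bijection `Hom_B(B ⊗_A M, N) ≃ Hom_A(M, N)`: `h ↦ (m ↦ h (1 ⊗ m))`, with inverse
`k ↦ (b ⊗ m ↦ b k(m))`. -/
def extHomEquiv (M : ModCat A) (N : ModCat B) :
    (extMod φ M ⟶ N) ≃ (M ⟶ (restrictScalars φ).obj N) where
  toFun h := mkHom ((λ_ M.X).inv ≫ MonObj.one ▷ M.X ≫ extπ φ M ≫ extHom φ h) (by
    have e1 := whiskerRight_extπ φ M
    have e2 := whiskerLeft_one_extAct φ M
    change act M ≫ (λ_ M.X).inv ≫ MonObj.one ▷ M.X ≫ extπ φ M ≫ extHom φ h =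
      A.X ◁ ((λ_ M.X).inv ≫ MonObj.one ▷ M.X ≫ extπ φ M ≫ extHom φ h) ≫ homX φ ▷ N.X ≫ act N
    rw [whisker_exchange_assoc, ← reassoc_of% e1]
    simp only [MonoidalCategory.whiskerLeft_comp, Category.assoc] at e2 ⊢
    rw [← extAct_extHom, reassoc_of% e2])
  invFun k := mkHom (extDesc φ k) (by
    change extAct φ M ≫ extDesc φ k = B.X ◁ extDesc φ k ≫ act N
    rw [← cancel_epi (B.X ◁ extπ φ M), reassoc_of% (extπ_extAct φ M),
      ← MonoidalCategory.whiskerLeft_comp_assoc, extπ_extDesc, ← whisker_exchange_assoc, mul_act]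
    simp)
  left_inv h := by
    ext
    change extDesc φ _ = extHom φ h
    rw [← cancel_epi (extπ φ M), extπ_extDesc]
    change B.X ◁ ((λ_ M.X).inv ≫ MonObj.one ▷ M.X ≫ extπ φ M ≫ extHom φ h) ≫ act N = _
    have e2 := whiskerLeft_one_extAct φ M
    simp only [MonoidalCategory.whiskerLeft_comp, Category.assoc] at e2 ⊢
    rw [← extAct_extHom, reassoc_of% e2]
  right_inv k := by
    ext
    change (λ_ M.X).inv ≫ MonObj.one ▷ M.X ≫ extπ φ M ≫ extDesc φ k = resHom φ k
    rw [extπ_extDesc, ← whisker_exchange_assoc, one_act]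
    simp

lemma extHomEquiv_naturality (M : ModCat A) (N N' : ModCat B) (g : N ⟶ N') (h : extMod φ M ⟶ N) :
    extHomEquiv φ M N' (h ≫ g) = extHomEquiv φ M N h ≫ (restrictScalars φ).map g := by
  ext
  change (λ_ M.X).inv ≫ MonObj.one ▷ M.X ≫ extπ φ M ≫ extHom φ h ≫ g.hom =
    ((λ_ M.X).inv ≫ MonObj.one ▷ M.X ≫ extπ φ M ≫ extHom φ h) ≫ g.hom
  simp only [Category.assoc]

/-- Extension of scalars `B ⊗_A - : A-Mod ⥤ B-Mod`. -/
def extendScalars : ModCat A ⥤ ModCat B :=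
  Adjunction.leftAdjointOfEquiv (extHomEquiv φ) (extHomEquiv_naturality φ)

/-- Extension of scalars is left adjoint to restriction of scalars. -/
def extendRestrictAdj : extendScalars φ ⊣ restrictScalars φ :=
  Adjunction.adjunctionOfEquivLeft (extHomEquiv φ) (extHomEquiv_naturality φ)

end Extend

end Modules

/-! ### Flat morphisms, Zariski open immersions, and the Zariski topology -/

section Zariski

variable (C : Type u) [Category.{v} C] [MonoidalCategory C] [SymmetricCategory C]

/-- The category `Aff_C = Comm(C)ᵒᵖ` of affine schemes over `C`. -/
abbrev Aff := (CommMon C)ᵒᵖ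

variable {C} [HasCoequalizers C] [MonoidalClosed C]

/-- `A ⟶ B` is flat if `B ⊗_A - : A-Mod ⥤ B-Mod` commutes with finite limits. -/
def IsFlat {A B : CommMon C} (φ : A ⟶ B) : Prop := PreservesFiniteLimits (extendScalars φ)

/-- `A ⟶ B` is of finite presentation if `Hom_{A/Comm(C)}(B, -)` commutes with filtered
colimits. -/
def IsOfFinitePresentation {A B : CommMon C} (φ : A ⟶ B) : Prop :=
  PreservesFilteredColimitsOfSize.{v, v} (coyoneda.obj (Opposite.op (Under.mk φ)))

/-- A morphism `Spec B ⟶ Spec A` is a Zariski open immersion if `A ⟶ B` is a flat epimorphism of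
finite presentation. -/
structure IsZariskiOpen {Y X : Aff C} (p : Y ⟶ X) : Prop where
  flat : IsFlat p.unop
  epi : Epi p.unop
  finitePresentation : IsOfFinitePresentation p.unop

variable (C) in
/-- The flat (fpqc) coverings: families of flat morphisms having a finite subfamily
`Spec A_j ⟶ Spec A` for which the functors `A_j ⊗_A -` are jointly conservative. -/
def fpqcPrecoverage : Precoverage (Aff C) where
  coverings X := { R | (∀ ⦃Y : Aff C⦄ (p : Y ⟶ X), R p → IsFlat p.unop) ∧
    ∃ (n : ℕ) (Y : Fin n → Aff C) (p : ∀ j, Y j ⟶ X), (∀ j, R (p j)) ∧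
      JointlyReflectIsomorphisms (fun j ↦ extendScalars (p j).unop) }

variable (C) in
/-- The Zariski coverings: flat coverings consisting of Zariski open immersions. -/
def zariskiPrecoverage : Precoverage (Aff C) where
  coverings X := { R | R ∈ fpqcPrecoverage C X ∧
    ∀ ⦃Y : Aff C⦄ (p : Y ⟶ X), R p → IsZariskiOpen p }

variable (C) in
/-- The Zariski topology on `Aff_C`. -/
def zariskiTopology : GrothendieckTopology (Aff C) := (zariskiPrecoverage C).toGrothendieck

variable (C) in
/-- The category `Sh(Aff_C)` of sheaves of sets for the Zariski topology. -/
abbrev Sh := Sheaf (zariskiTopology C) (Type (max u v))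

/-- `Sh(Aff_C)` has coproducts. -/
instance (I : Type v) : HasColimitsOfShape (Discrete I) (Sh C) := by
  have h1 : HasColimitsOfShape (Discrete I) (Type (max u v)) := inferInstance
  have h2 : HasWeakSheafify (zariskiTopology C) (Type (max u v)) := inferInstance
  exact ⟨fun _ ↦ HasColimit.mk ⟨Sheaf.sheafifyCocone (colimit.cocone _),
    Sheaf.isColimitSheafifyCocone _ (colimit.isColimit _)⟩⟩

end Zariski

/-! ### Relative schemes -/

section Schemes

variable (C : Type u) [Category.{v} C] [MonoidalCategory C] [SymmetricCategory C]
  [HasCoequalizers C] [MonoidalClosed C] [(zariskiTopology C).Subcanonical]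

/-- The Yoneda embedding `Aff_C ⥤ Sh(Aff_C)`. -/
abbrev affSheaf : Aff C ⥤ Sh C := GrothendieckTopology.uliftYoneda.{u} (zariskiTopology C)

variable {C}

/-- A morphism of sheaves `i : F ⟶ X` to an affine scheme exhibits `F` as a Zariski open of `X`
if it is a monomorphism and `F` is the image of `∐ X_i ⟶ X` for a family of Zariski open
immersions `X_i ⟶ X` of affine schemes, i.e. if `∐ X_i ⟶ X` factors as an epimorphism
`∐ X_i ⟶ F` followed by `i`. -/
def IsOpenOfAffine {X : Aff C} {F : Sh C} (i : F ⟶ (affSheaf C).obj X) : Prop :=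
  Mono i ∧ ∃ (I : Type v) (U : I → Aff C) (p : ∀ k, U k ⟶ X)
    (q : ∀ k, (affSheaf C).obj (U k) ⟶ F),
    (∀ k, IsZariskiOpen (p k)) ∧ (∀ k, q k ≫ i = (affSheaf C).map (p k)) ∧ Epi (Limits.Sigma.desc q)

/-- A morphism of sheaves `F ⟶ G` is a Zariski open immersion if for every affine scheme `X` and
every `X ⟶ G`, the projection `F ×_G X ⟶ X` is a monomorphism whose image is a Zariski open
of `X`. -/
def IsOpenImmersion {F G : Sh C} (φ : F ⟶ G) : Prop :=
  ∀ (X : Aff C) (x : (affSheaf C).obj X ⟶ G), IsOpenOfAffine (pullback.snd φ x)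

variable (C) in
/-- The property of sheaves of being a scheme relative to `C`: there is an epimorphism
`∐ X_i ⟶ F` from a coproduct of affine schemes all of whose components `X_i ⟶ F` are Zariski open
immersions. -/
def isScheme : ObjectProperty (Sh C) := fun F ↦
  ∃ (I : Type v) (X : I → Aff C) (p : ∀ k, (affSheaf C).obj (X k) ⟶ F),
    Epi (Limits.Sigma.desc p) ∧ ∀ k, IsOpenImmersion (p k)

variable (C) in
/-- The category of schemes relative to `C`. -/
abbrev Sch := (isScheme C).FullSubcategory

end Schemes

/-! ### Base change -/

section BaseChange

variable {C D : Type u} [Category.{v} C] [MonoidalCategory C] [SymmetricCategory C]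
  [Category.{v} D] [MonoidalCategory D] [SymmetricCategory D]
  {f : C ⥤ D} [f.Braided] {g : D ⥤ C} (adj : f ⊣ g)

/-- The right adjoint of a symmetric monoidal functor is lax symmetric monoidal. -/
@[reducible] def rightLaxBraided : g.LaxBraided :=
  letI := adj.rightAdjointLaxMonoidal
  { braided := fun X Y ↦ by
      change adj.homEquiv _ _ _ ≫ g.map _ = _ ≫ adj.homEquiv _ _ _
      rw [← Adjunction.homEquiv_naturality_right, ← Adjunction.homEquiv_naturality_left]
      congr 1
      rw [Category.assoc, BraidedCategory.braiding_naturality, ← Category.assoc, ← Category.assoc,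
        Functor.map_braiding]
      simp }

/-- The functor `Comm(D) ⥤ Comm(C)` induced by `g`. -/
def commRight : CommMon D ⥤ CommMon C :=
  letI := rightLaxBraided adj
  g.mapCommMon

/-- The adjunction between `Comm(C)` and `Comm(D)` induced by `f ⊣ g`. -/
def commAdj : f.mapCommMon ⊣ commRight adj :=
  letI := rightLaxBraided adj
  haveI : adj.IsMonoidal := ⟨rfl, fun _ _ ↦ rfl⟩
  adj.mapCommMon

/-- The morphism of `C` underlying the unit `A ⟶ g(f(A))`. -/
def unitX (A : CommMon C) : A.X ⟶ g.obj (f.obj A.X) := homX ((commAdj adj).unit.app A)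

lemma unitX_eq (A : CommMon C) : unitX adj A = adj.unit.app A.X := by
  have h : unitX adj A = 𝟙 A.X ≫ adj.unit.app A.X ≫ 𝟙 (g.obj (f.obj A.X)) := by
    simp only [unitX, homX, commAdj]
    rfl
  rw [h, Category.id_comp]
  exact Category.comp_id _

variable (f) in
/-- The functor `f : Aff_C ⥤ Aff_D`. -/
abbrev affLeft : Aff C ⥤ Aff D := f.mapCommMon.op

/-- The functor `g : Aff_D ⥤ Aff_C`, left adjoint to `f : Aff_C ⥤ Aff_D`. -/
abbrev affRight : Aff D ⥤ Aff C := (commRight adj).op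

/-- The structure map `g(X) ⊗ g(Y) ⟶ g(X ⊗ Y)`. -/
def rightμ (X Y : D) : g.obj X ⊗ g.obj Y ⟶ g.obj (X ⊗ Y) :=
  letI := adj.rightAdjointLaxMonoidal
  Functor.LaxMonoidal.μ g X Y

/-- The functor `B-Mod ⥤ g(B)-Mod` induced by `g`: the action on `g(N)` is
`g(B) ⊗ g(N) ⟶ g(B ⊗ N) ⟶ g(N)`. -/
def rightMod (B : CommMon D) : ModCat B ⥤ ModCat ((commRight adj).obj B) where
  obj N := mkMod (A := (commRight adj).obj B) (g.obj N.X) (rightμ adj B.X N.X ≫ g.map (act N))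
    (by
      let := adj.rightAdjointLaxMonoidal
      change (Functor.LaxMonoidal.ε g ≫ g.map MonObj.one) ▷ g.obj N.X ≫
        Functor.LaxMonoidal.μ g B.X N.X ≫ g.map (act N) = _
      rw [comp_whiskerRight_assoc, Functor.LaxMonoidal.μ_natural_left_assoc, ← g.map_comp, one_act]
      simp)
    (by
      let := adj.rightAdjointLaxMonoidal
      change (Functor.LaxMonoidal.μ g B.X B.X ≫ g.map MonObj.mul) ▷ g.obj N.X ≫
        Functor.LaxMonoidal.μ g B.X N.X ≫ g.map (act N) = (α_ (g.obj B.X) (g.obj B.X) _).hom ≫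
          g.obj B.X ◁ (Functor.LaxMonoidal.μ g B.X N.X ≫ g.map (act N)) ≫
            Functor.LaxMonoidal.μ g B.X N.X ≫ g.map (act N)
      rw [comp_whiskerRight_assoc, Functor.LaxMonoidal.μ_natural_left_assoc, ← g.map_comp, mul_act,
        MonoidalCategory.whiskerLeft_comp_assoc, Functor.LaxMonoidal.μ_natural_right_assoc]
      simp)
  map {N N'} h := mkHom (M := mkMod (A := (commRight adj).obj B) (g.obj N.X) _ _ _)
    (N := mkMod (A := (commRight adj).obj B) (g.obj N'.X) _ _ _) (g.map h.hom) (by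
      let := adj.rightAdjointLaxMonoidal
      change (Functor.LaxMonoidal.μ g B.X N.X ≫ g.map (act N)) ≫ g.map h.hom =
        g.obj B.X ◁ g.map h.hom ≫ Functor.LaxMonoidal.μ g B.X N'.X ≫ g.map (act N')
      rw [Functor.LaxMonoidal.μ_natural_right_assoc, Category.assoc, ← g.map_comp, ← g.map_comp,
        act_hom])
  map_id _ := by ext; exact g.map_id _
  map_comp _ _ := by ext; exact g.map_comp _ _

/-- The functor `g : f(A)-Mod ⥤ A-Mod`: the `g(f(A))`-module `g(N)` is seen as an `A`-module
through the unit `A ⟶ g(f(A))`. -/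
def gMod (A : CommMon C) : ModCat (f.mapCommMon.obj A) ⥤ ModCat A :=
  rightMod adj _ ⋙ restrictScalars ((commAdj adj).unit.app A)

lemma gModRestrict_aux {A B : C} (h : A ⟶ B) {P : D} (a : f.obj B ⊗ P ⟶ P) :
    (adj.unit.app A ▷ g.obj P ≫ rightμ adj (f.obj A) P ≫ g.map (f.map h ▷ P ≫ a)) ≫ 𝟙 _ =
      A ◁ 𝟙 _ ≫ h ▷ g.obj P ≫ adj.unit.app B ▷ g.obj P ≫ rightμ adj (f.obj B) P ≫ g.map a := by
  let := adj.rightAdjointLaxMonoidal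
  have e : h ≫ adj.unit.app B = adj.unit.app A ≫ g.map (f.map h) := adj.unit.naturality h
  have e' : rightμ adj (f.obj A) P ≫ g.map (f.map h ▷ P) =
      g.map (f.map h) ▷ g.obj P ≫ rightμ adj (f.obj B) P :=
    (Functor.LaxMonoidal.μ_natural_left (F := g) (f.map h) P).symm
  rw [MonoidalCategory.whiskerLeft_id, Category.id_comp, Category.comp_id, g.map_comp,
    reassoc_of% e', ← comp_whiskerRight_assoc, ← e, comp_whiskerRight_assoc]

/-- The functors `g` commute with restriction of scalars (by the identity of `g(P)`). -/
def gModRestrict {A B : CommMon C} (φ : A ⟶ B) (P : ModCat (f.mapCommMon.obj B)) :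
    (gMod adj A).obj ((restrictScalars (f.mapCommMon.map φ)).obj P) ⟶
      (restrictScalars φ).obj ((gMod adj B).obj P) :=
  mkHom (𝟙 (g.obj P.X)) (by
    have h := gModRestrict_aux adj (homX φ) (P := P.X) (act P)
    rw [← unitX_eq, ← unitX_eq] at h
    exact h)

variable [HasCoequalizers C] [MonoidalClosed C] [HasCoequalizers D] [MonoidalClosed D]

/-- The natural morphism `g(N) ⊗_A B ⟶ g(N ⊗_{f(A)} f(B))` of `B`-modules: the adjoint of the
`A`-linear map obtained by applying `g` to the unit `N ⟶ N ⊗_{f(A)} f(B)`. -/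
def baseChangeMap {A B : CommMon C} (φ : A ⟶ B) (N : ModCat (f.mapCommMon.obj A)) :
    (extendScalars φ).obj ((gMod adj A).obj N) ⟶
      (gMod adj B).obj ((extendScalars (f.mapCommMon.map φ)).obj N) :=
  ((extendRestrictAdj φ).homEquiv _ _).symm
    ((gMod adj A).map ((extendRestrictAdj (f.mapCommMon.map φ)).unit.app N) ≫
      gModRestrict adj φ _)

/-- The functor `f^~_! : Sh(Aff_C) ⥤ Sh(Aff_D)`: the sheaf associated to the presheaf
`f_!(F) = F ∘ g`. -/
def shriek : Sh C ⥤ Sh D :=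
  sheafToPresheaf _ _ ⋙ (Functor.whiskeringLeft _ _ _).obj (affRight adj).op ⋙
    presheafToSheaf (zariskiTopology D) (Type (max u v))

end BaseChange

end

end RelSch

/-! The engine is the base change hypothesis, which for `A ⟶ B` flat identifies `g ∘ (f(B) ⊗_{f(A)}
-)` with `(B ⊗_A -) ∘ g` on modules (`gModExtendIso`). On modules `g` preserves finite limits, being
a right adjoint on underlying objects, and it is conservative, so it also reflects them.
Preservation of finite limits and joint conservativity therefore pass from `B ⊗_A -` to `f(B)
⊗_{f(A)} -` (`IsFlat.mapCommMon`, `Conservative.affLeft`). Epimorphisms are preserved because `f` is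
a left adjoint on commutative monoids, and finite presentation is preserved because its right
adjoint commutes with filtered colimits. Hence `f` sends Zariski coverings to Zariski coverings. It
also preserves pullbacks of affine schemes, so it is continuous (`isContinuous_affLeft`).

By continuity, `shriek` is left adjoint to precomposition with `f`, so it preserves jointly
epimorphic families. It is left exact because sheafification is. It extends `f` on affine schemes
because `h_X ∘ g` is represented by `f(X)` and representables are sheaves. Consequently an affine
atlas of `F` is sent to a jointly epimorphic affine family over the image of `F`. What is left is
that its members are open immersions (`IsOpenImmersion.shriek`). This has to be tested on an
arbitrary affine `Y` over the image of `F`. Such a point comes from a point of `F` only locally on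
`Y` (`exists_local_lift`), which suffices because being an open of an affine scheme is local on the
base (`isOpenOfAffine_of_cover`).

This relies on the following facts about affine schemes. Zariski open immersions and coverings are
stable under composition and base change, which comes from pushouts of commutative monoids and from
`B ⊗_A M ≅ (B ⊗_A A') ⊗_{A'} M` (`baseChangeIso`). The topology is subcanonical by flat descent
(`existsUnique_of_cover`). Epimorphisms in `Sh` are the locally surjective morphisms
(`jointlyEpi_iff`). Filtered colimits of commutative monoids are computed in the ambient category,
by siftedness. -/

namespace RelSch

noncomputable section

/-! ### Limits of modules are computed on underlying objects -/

section ModuleLimits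

variable {C : Type u} [Category.{v} C] [MonoidalCategory C] [SymmetricCategory C]

/-- The forgetful functor from modules to the ambient category. -/
abbrev forgetMod (A : CommMon C) : ModCat A ⥤ C := Mod.forget A.X

instance (A : CommMon C) : (forgetMod A).Faithful where
  map_injective h := Mod.hom_ext _ _ h

instance (A : CommMon C) : (forgetMod A).ReflectsIsomorphisms where
  reflects {M N} h _ := by
    have : IsIso h.hom := ‹IsIso ((forgetMod A).map h)›
    refine ⟨mkHom (inv h.hom) ?_, ?_, ?_⟩
    · rw [IsIso.comp_inv_eq, Category.assoc, act_hom, ← MonoidalCategory.whiskerLeft_comp_assoc]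
      simp
    · ext; exact IsIso.hom_inv_id h.hom
    · ext; exact IsIso.inv_hom_id h.hom

lemma isIso_of_hom {A : CommMon C} {M N : ModCat A} (h : M ⟶ N) [IsIso h.hom] : IsIso h := by
  have : IsIso ((forgetMod A).map h) := ‹IsIso h.hom›
  exact isIso_of_reflects_iso h (forgetMod A)

instance {A : CommMon C} {M N : ModCat A} (h : M ⟶ N) [IsIso h] : IsIso h.hom :=
  inferInstanceAs (IsIso ((forgetMod A).map h))

variable {J : Type*} [Category* J] {A : CommMon C}

/-- The legs of a cone over the underlying objects of a diagram of modules. -/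
def leg {F : J ⥤ ModCat A} (c : Cone (F ⋙ forgetMod A)) (j : J) : c.pt ⟶ (F.obj j).X := c.π.app j

lemma leg_map {F : J ⥤ ModCat A} (c : Cone (F ⋙ forgetMod A)) {i j : J} (f : i ⟶ j) :
    leg c i ≫ (F.map f).hom = leg c j := c.w f

/-- A cone over the underlying objects of a diagram of modules from its legs. -/
def mkCone {F : J ⥤ ModCat A} {X : C} (p : ∀ j, X ⟶ (F.obj j).X)
    (w : ∀ {i j : J} (f : i ⟶ j), p i ≫ (F.map f).hom = p j) : Cone (F ⋙ forgetMod A) where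
  pt := X
  π :=
    { app := p
      naturality := fun _ _ f ↦ (Category.id_comp _).trans (w f).symm }

/-- The morphism to a limit of underlying objects of modules. -/
def liftLeg {F : J ⥤ ModCat A} {c : Cone (F ⋙ forgetMod A)} (hc : IsLimit c) {X : C}
    (p : ∀ j, X ⟶ (F.obj j).X) (w : ∀ {i j : J} (f : i ⟶ j), p i ≫ (F.map f).hom = p j) :
    X ⟶ c.pt := hc.lift (mkCone p w)

lemma liftLeg_leg {F : J ⥤ ModCat A} {c : Cone (F ⋙ forgetMod A)} (hc : IsLimit c) {X : C}
    (p : ∀ j, X ⟶ (F.obj j).X) (w : ∀ {i j : J} (f : i ⟶ j), p i ≫ (F.map f).hom = p j) (j : J) :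
    liftLeg hc p w ≫ leg c j = p j := hc.fac (mkCone p w) j

lemma hom_ext_leg {F : J ⥤ ModCat A} {c : Cone (F ⋙ forgetMod A)} (hc : IsLimit c) {X : C}
    {a b : X ⟶ c.pt} (h : ∀ j, a ≫ leg c j = b ≫ leg c j) : a = b := hc.hom_ext h

lemma cone_hom_w {F : J ⥤ ModCat A} (s : Cone F) {i j : J} (f : i ⟶ j) :
    (s.π.app i).hom ≫ (F.map f).hom = (s.π.app j).hom := congrArg Mod.Hom.hom (s.w f)

/-- The action on the limit of the underlying objects of a diagram of modules. -/
def limitAct {F : J ⥤ ModCat A} {c : Cone (F ⋙ forgetMod A)} (hc : IsLimit c) :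
    A.X ⊗ c.pt ⟶ c.pt :=
  liftLeg hc (fun j ↦ A.X ◁ leg c j ≫ act (F.obj j)) (fun f ↦ by
    rw [Category.assoc, act_hom, ← leg_map c f]
    simp)

lemma limitAct_leg {F : J ⥤ ModCat A} {c : Cone (F ⋙ forgetMod A)} (hc : IsLimit c) (j : J) :
    limitAct hc ≫ leg c j = A.X ◁ leg c j ≫ act (F.obj j) :=
  hc.fac (mkCone _ _) j

/-- The limit of a diagram of modules. -/
def limitMod {F : J ⥤ ModCat A} {c : Cone (F ⋙ forgetMod A)} (hc : IsLimit c) : ModCat A :=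
  mkMod c.pt (limitAct hc)
    (hom_ext_leg hc fun j ↦ by
      rw [Category.assoc, limitAct_leg, ← whisker_exchange_assoc, one_act]
      simp)
    (hom_ext_leg hc fun j ↦ by
      rw [Category.assoc, limitAct_leg, ← whisker_exchange_assoc, Category.assoc, Category.assoc,
        limitAct_leg, ← MonoidalCategory.whiskerLeft_comp_assoc, limitAct_leg, mul_act]
      simp)

/-- The limit cone of a diagram of modules. -/
def limitModCone {F : J ⥤ ModCat A} {c : Cone (F ⋙ forgetMod A)} (hc : IsLimit c) : Cone F where
  pt := limitMod hc
  π :=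
    { app := fun j ↦ mkHom (M := limitMod hc) (leg c j) (limitAct_leg hc j)
      naturality := fun i j f ↦ by
        ext
        exact (Category.id_comp _).trans (leg_map c f).symm }

lemma act_liftLeg {F : J ⥤ ModCat A} {c : Cone (F ⋙ forgetMod A)} (hc : IsLimit c) (s : Cone F) :
    act s.pt ≫ liftLeg hc (fun j ↦ (s.π.app j).hom) (cone_hom_w s) =
      A.X ◁ liftLeg hc (fun j ↦ (s.π.app j).hom) (cone_hom_w s) ≫ limitAct hc :=
  hom_ext_leg hc fun j ↦ by
    rw [Category.assoc, Category.assoc, limitAct_leg, liftLeg_leg,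
      ← MonoidalCategory.whiskerLeft_comp_assoc, liftLeg_leg]
    exact act_hom (s.π.app j)

/-- The limit cone of a diagram of modules is a limit cone. -/
def isLimitLimitModCone {F : J ⥤ ModCat A} {c : Cone (F ⋙ forgetMod A)} (hc : IsLimit c) :
    IsLimit (limitModCone hc) where
  lift s := mkHom (N := limitMod hc) (liftLeg hc (fun j ↦ (s.π.app j).hom) (cone_hom_w s))
    (act_liftLeg hc s)
  fac s j := by
    ext
    exact hc.fac (mkCone _ (cone_hom_w s)) j
  uniq s m w := by
    ext
    exact hc.uniq (mkCone _ (cone_hom_w s)) m.hom fun j ↦ congrArg Mod.Hom.hom (w j)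

/-- Since the forgetful functor reflects isomorphisms, it is enough to lift each limit cone to one
limit cone of modules. Finite limits of modules, and hence flatness, can then be tested in `C`. -/
instance (F : J ⥤ ModCat A) : CreatesLimit F (forgetMod A) :=
  createsLimitOfReflectsIso fun _ hc ↦
    { liftedCone := limitModCone hc
      validLift := Cone.ext (Iso.refl _) fun _ ↦ (Category.id_comp _).symm
      makesLimit := isLimitLimitModCone hc }

instance : CreatesLimitsOfShape J (forgetMod A) := ⟨inferInstance⟩

instance [HasLimitsOfShape J C] : HasLimitsOfShape J (ModCat A) :=
  hasLimitsOfShape_of_hasLimitsOfShape_createsLimitsOfShape (forgetMod A)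

instance [HasFiniteLimits C] : HasFiniteLimits (ModCat A) := ⟨fun _ _ _ ↦ inferInstance⟩

instance [HasLimitsOfShape J C] : PreservesLimitsOfShape J (forgetMod A) :=
  preservesLimitOfShape_of_createsLimitsOfShape_and_hasLimitsOfShape _

/-- A functor to modules preserves the limits that it preserves on underlying objects. -/
lemma preservesLimitsOfShape_of_comp_forgetMod {𝒜 : Type*} [Category* 𝒜] [HasLimitsOfShape J C]
    (F : 𝒜 ⥤ ModCat A) [PreservesLimitsOfShape J (F ⋙ forgetMod A)] :
    PreservesLimitsOfShape J F :=
  preservesLimitsOfShape_of_reflects_of_preserves F (forgetMod A)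

end ModuleLimits

/-! ### Functoriality of restriction and extension of scalars -/

section Restrict

variable {C : Type u} [Category.{v} C] [MonoidalCategory C] [SymmetricCategory C]
  {A B E : CommMon C} (φ : A ⟶ B) (ψ : B ⟶ E)

instance : (restrictScalars φ).ReflectsIsomorphisms where
  reflects h _ := by
    have : IsIso h.hom := inferInstanceAs (IsIso ((restrictScalars φ).map h).hom)
    exact isIso_of_hom h

/-- Restriction of scalars does not change the underlying object. -/
def restrictForget : restrictScalars φ ⋙ forgetMod A ≅ forgetMod B :=
  NatIso.ofComponents (fun _ ↦ Iso.refl _)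
    fun h ↦ (Category.comp_id h.hom).trans (Category.id_comp h.hom).symm

instance {J : Type*} [Category* J] [HasLimitsOfShape J C] :
    PreservesLimitsOfShape J (restrictScalars φ) :=
  have : PreservesLimitsOfShape J (restrictScalars φ ⋙ forgetMod A) :=
    preservesLimitsOfShape_of_natIso (restrictForget φ).symm
  preservesLimitsOfShape_of_comp_forgetMod _

/-- An isomorphism of modules from an isomorphism of the underlying objects. -/
def mkIso {M N : ModCat A} (e : M.X ≅ N.X) (w : act M ≫ e.hom = A.X ◁ e.hom ≫ act N) : M ≅ N :=
  letI h := mkHom e.hom w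
  haveI : IsIso h.hom := inferInstanceAs (IsIso e.hom)
  haveI : IsIso h := isIso_of_hom h
  asIso h

/-- Restriction of scalars along a composition. -/
def restrictComp : restrictScalars (φ ≫ ψ) ≅ restrictScalars ψ ⋙ restrictScalars φ :=
  NatIso.ofComponents (fun N ↦ mkIso (Iso.refl N.X) (by
    change (homX (φ ≫ ψ) ▷ N.X ≫ act N) ≫ 𝟙 N.X =
      A.X ◁ 𝟙 N.X ≫ homX φ ▷ N.X ≫ homX ψ ▷ N.X ≫ act N
    have h : homX (φ ≫ ψ) = homX φ ≫ homX ψ := rfl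
    rw [h]
    simp))
    (fun h ↦ by
      ext
      exact (Category.comp_id h.hom).trans (Category.id_comp h.hom).symm)

/-- Restriction of scalars along the identity. -/
def restrictId (A : CommMon C) : restrictScalars (𝟙 A) ≅ 𝟭 (ModCat A) :=
  NatIso.ofComponents (fun N ↦ mkIso (Iso.refl N.X) (by
    change (homX (𝟙 A) ▷ N.X ≫ act N) ≫ 𝟙 N.X = A.X ◁ 𝟙 N.X ≫ act N
    have h : homX (𝟙 A) = 𝟙 A.X := rfl
    rw [h]
    simp))
    (fun h ↦ by
      ext
      exact (Category.comp_id h.hom).trans (Category.id_comp h.hom).symm)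

lemma isEquivalence_restrictScalars [IsIso φ] : (restrictScalars φ).IsEquivalence :=
  (CategoryTheory.Equivalence.mk (restrictScalars φ) (restrictScalars (inv φ))
    ((restrictId B).symm ≪≫ (eqToIso (by rw [IsIso.inv_hom_id])) ≪≫ restrictComp (inv φ) φ)
    ((restrictComp φ (inv φ)).symm ≪≫ (eqToIso (by rw [IsIso.hom_inv_id])) ≪≫
      restrictId A)).isEquivalence_functor

variable [HasCoequalizers C] [MonoidalClosed C]

/-- Extension of scalars along a composition. -/
def extendComp : extendScalars (φ ≫ ψ) ≅ extendScalars φ ⋙ extendScalars ψ :=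
  Adjunction.leftAdjointUniq (extendRestrictAdj (φ ≫ ψ))
    (((extendRestrictAdj φ).comp (extendRestrictAdj ψ)).ofNatIsoRight (restrictComp φ ψ).symm)

lemma isEquivalence_extendScalars [IsIso φ] : (extendScalars φ).IsEquivalence :=
  have := isEquivalence_restrictScalars φ
  (extendRestrictAdj φ).isEquivalence_left_of_isEquivalence_right

lemma isFlat_of_isIso [IsIso φ] : IsFlat φ := by
  have := isEquivalence_extendScalars φ
  exact ⟨fun _ _ _ ↦ inferInstance⟩

variable {φ ψ} in
lemma IsFlat.comp (hφ : IsFlat φ) (hψ : IsFlat ψ) : IsFlat (φ ≫ ψ) := by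
  have : PreservesFiniteLimits (extendScalars φ) := hφ
  have : PreservesFiniteLimits (extendScalars ψ) := hψ
  exact preservesFiniteLimits_of_natIso (extendComp φ ψ).symm

/-- The morphism of `C` underlying a morphism of extended modules. -/
def extMap {M N : ModCat A} (h : M ⟶ N) : extObj φ M ⟶ extObj φ N :=
  ((extendScalars φ).map h).hom

/-- The morphism `m ↦ 1 ⊗ m` of `C`. -/
def extι (M : ModCat A) : M.X ⟶ extObj φ M := (λ_ M.X).inv ≫ MonObj.one ▷ M.X ≫ extπ φ M

/-- `extendScalars` is built from a family of bijections of Hom sets, so its action on morphisms is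
not given by a formula. The explicit unit proved here is what the formulas for `extMap` below are
derived from. -/
lemma extendRestrictAdj_unit_hom (M : ModCat A) :
    ((extendRestrictAdj φ).unit.app M).hom = extι φ M := by
  have h : (extendRestrictAdj φ).unit.app M = extHomEquiv φ M _ (𝟙 (extMod φ M)) := by
    simp [extendRestrictAdj, Adjunction.adjunctionOfEquivLeft]
    rfl
  rw [h]
  change (λ_ M.X).inv ≫ MonObj.one ▷ M.X ≫ extπ φ M ≫ 𝟙 _ = _
  rw [Category.comp_id]
  rfl

lemma extι_extMap {M N : ModCat A} (h : M ⟶ N) : extι φ M ≫ extMap φ h = h.hom ≫ extι φ N := by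
  have e := congrArg Mod.Hom.hom ((extendRestrictAdj φ).unit.naturality h)
  refine (?_ : _ = ((extendRestrictAdj φ).unit.app M).hom ≫ extMap φ h).trans e.symm |>.trans ?_
  · rw [extendRestrictAdj_unit_hom]; rfl
  · refine (?_ : h.hom ≫ ((extendRestrictAdj φ).unit.app N).hom = _)
    rw [extendRestrictAdj_unit_hom]; rfl

/-- In elements: `b ⊗ m = b (1 ⊗ m)`. -/
lemma extπ_eq (M : ModCat A) : extπ φ M = B.X ◁ extι φ M ≫ extAct φ M :=
  (whiskerLeft_one_extAct φ M).symm

lemma extAct_extMap {M N : ModCat A} (h : M ⟶ N) :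
    extAct φ M ≫ extMap φ h = B.X ◁ extMap φ h ≫ extAct φ N :=
  act_hom ((extendScalars φ).map h)

/-- By `B`-linearity, the extended map is determined by its values on the elements `1 ⊗ m`, and
these are given by naturality of the unit. -/
lemma extπ_extMap {M N : ModCat A} (h : M ⟶ N) :
    extπ φ M ≫ extMap φ h = B.X ◁ h.hom ≫ extπ φ N := by
  rw [extπ_eq, Category.assoc, extAct_extMap, ← MonoidalCategory.whiskerLeft_comp_assoc,
    extι_extMap, MonoidalCategory.whiskerLeft_comp_assoc, ← extπ_eq]

end Restrict

/-! ### Reflexive coequalizers of commutative monoids -/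

section Quotient

variable {C : Type u} [Category.{v} C] [MonoidalCategory C] [SymmetricCategory C]

/-- A morphism of commutative monoids from a morphism of monoid objects. -/
def mkMonHom {A B : CommMon C} (h : A.X ⟶ B.X) (hh : IsMonHom h) : A ⟶ B :=
  letI : IsMonHom (M := A.toMon.X) (N := B.toMon.X) h := hh
  CommMon.homMk (Mon.Hom.mk (M := A.toMon) (N := B.toMon) h)

@[simp] lemma homX_comp {A B E : CommMon C} (φ : A ⟶ B) (ψ : B ⟶ E) :
    homX (φ ≫ ψ) = homX φ ≫ homX ψ := rfl

lemma homX_injective {A B : CommMon C} {φ ψ : A ⟶ B} (h : homX φ = homX ψ) : φ = ψ :=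
  CommMon.hom_ext _ _ h

instance {A B : CommMon C} (φ : A ⟶ B) [IsIso φ] : IsIso (homX φ) :=
  inferInstanceAs (IsIso ((CommMon.forget C).map φ))

/-- This is the Eckmann-Hilton interchange, where commutativity enters. It makes `pairL`, `pairR`
and `tensorDesc` below morphisms of monoids. -/
instance (M : C) [MonObj M] [IsCommMonObj M] : IsMonHom (MonObj.mul (X := M)) where
  one_hom := by
    rw [MonObj.tensorObj.one_def, MonoidalCategory.tensorHom_def, Category.assoc, Category.assoc,
      MonObj.mul_one, rightUnitor_naturality, ← unitors_equal, Iso.inv_hom_id_assoc]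
  mul_hom := by
    rw [MonObj.tensorObj.mul_def, Category.assoc, MonObj.mul_mul_mul_comm]

variable [HasCoequalizers C] [MonoidalClosed C]

lemma exists_desc_left {X Y Z W : C} (a b : X ⟶ Y) (h : Z ⊗ Y ⟶ W)
    (w : Z ◁ a ≫ h = Z ◁ b ≫ h) : ∃ k : Z ⊗ coequalizer a b ⟶ W, Z ◁ coequalizer.π a b ≫ k = h :=
  ⟨_, id_tensor_π_preserves_coequalizer_inv_desc a b h w⟩

lemma exists_desc_right {X Y Z W : C} (a b : X ⟶ Y) (h : Y ⊗ Z ⟶ W)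
    (w : a ▷ Z ≫ h = b ▷ Z ≫ h) : ∃ k : coequalizer a b ⊗ Z ⟶ W, coequalizer.π a b ▷ Z ≫ k = h := by
  obtain ⟨k, hk⟩ := exists_desc_left a b ((β_ Z Y).hom ≫ h) (by
    rw [BraidedCategory.braiding_naturality_right_assoc, w,
      BraidedCategory.braiding_naturality_right_assoc])
  refine ⟨(β_ _ _).hom ≫ k, ?_⟩
  rw [BraidedCategory.braiding_naturality_left_assoc, hk, SymmetricCategory.symmetry_assoc]

instance epi_whiskerLeft {X Y : C} (Z : C) (q : X ⟶ Y) [Epi q] : Epi (Z ◁ q) :=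
  inferInstanceAs (Epi ((tensorLeft Z).map q))

instance epi_whiskerRight {X Y : C} (Z : C) (q : X ⟶ Y) [Epi q] : Epi (q ▷ Z) := by
  have h : q ▷ Z = (β_ X Z).hom ≫ Z ◁ q ≫ (β_ Y Z).inv := by simp
  rw [h]
  infer_instance

instance epi_tensorHom {X Y Z W : C} (q : X ⟶ Y) (r : Z ⟶ W) [Epi q] [Epi r] : Epi (q ⊗ₘ r) := by
  rw [MonoidalCategory.tensorHom_def]
  infer_instance

variable {S T : C} [MonObj S] [MonObj T] {a b : S ⟶ T} [IsMonHom a] [IsMonHom b] {s : T ⟶ S}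

/-- In elements: `t c(x) = c(s(t)) c(x) = c(s(t) x)`. The section `s` need not be a morphism of
monoids. -/
lemma whiskerLeft_mul_of_section (c : S ⟶ T) [IsMonHom c] (hc : s ≫ c = 𝟙 T) :
    T ◁ c ≫ MonObj.mul = s ▷ S ≫ MonObj.mul ≫ c := by
  rw [IsMonHom.mul_hom, MonoidalCategory.tensorHom_def, Category.assoc, ← comp_whiskerRight_assoc,
    hc]
  simp

lemma whiskerRight_mul_of_section (c : S ⟶ T) [IsMonHom c] (hc : s ≫ c = 𝟙 T) :
    c ▷ T ≫ MonObj.mul = S ◁ s ≫ MonObj.mul ≫ c := by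
  rw [IsMonHom.mul_hom, MonoidalCategory.tensorHom_def', Category.assoc,
    ← MonoidalCategory.whiskerLeft_comp_assoc, hc]
  simp

/-- The product descends one variable at a time. By the common section, `t a(x) = a(s(t) x)` and `t
b(x) = b(s(t) x)`, which have the same image in the quotient. Without reflexivity the coequalizer in
`C` need not be an ideal quotient. -/
lemma exists_quotMul (ha : s ≫ a = 𝟙 T) (hb : s ≫ b = 𝟙 T) :
    ∃ m : coequalizer a b ⊗ coequalizer a b ⟶ coequalizer a b,
      (coequalizer.π a b ⊗ₘ coequalizer.π a b) ≫ m = MonObj.mul ≫ coequalizer.π a b := by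
  obtain ⟨k, hk⟩ := exists_desc_left (Z := T) a b (MonObj.mul ≫ coequalizer.π a b) (by
    rw [reassoc_of% whiskerLeft_mul_of_section a ha, reassoc_of% whiskerLeft_mul_of_section b hb,
      coequalizer.condition])
  obtain ⟨m, hm⟩ := exists_desc_right (Z := coequalizer a b) a b k (by
    rw [← cancel_epi (S ◁ coequalizer.π a b), whisker_exchange_assoc, hk, whisker_exchange_assoc,
      hk, reassoc_of% whiskerRight_mul_of_section a ha,
      reassoc_of% whiskerRight_mul_of_section b hb, coequalizer.condition])
  refine ⟨m, ?_⟩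
  rw [MonoidalCategory.tensorHom_def', Category.assoc, hm, hk]

/-- The monoid structure on the coequalizer of a reflexive pair of morphisms of monoids. -/
@[reducible] def quotMonObj (ha : s ≫ a = 𝟙 T) (hb : s ≫ b = 𝟙 T) : MonObj (coequalizer a b) :=
  letI m := (exists_quotMul ha hb).choose
  have hm : (coequalizer.π a b ⊗ₘ coequalizer.π a b) ≫ m = MonObj.mul ≫ coequalizer.π a b :=
    (exists_quotMul ha hb).choose_spec
  have hm' : coequalizer.π a b ▷ _ ≫ _ ◁ coequalizer.π a b ≫ m =
      MonObj.mul ≫ coequalizer.π a b := by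
    rw [← hm, MonoidalCategory.tensorHom_def, Category.assoc]
  have hm'' : _ ◁ coequalizer.π a b ≫ coequalizer.π a b ▷ _ ≫ m =
      MonObj.mul ≫ coequalizer.π a b := by
    rw [← hm, MonoidalCategory.tensorHom_def', Category.assoc]
  { one := MonObj.one ≫ coequalizer.π a b
    mul := m
    one_mul := by
      rw [← cancel_epi (𝟙_ C ◁ coequalizer.π a b), comp_whiskerRight, Category.assoc,
        whisker_exchange_assoc, hm'', MonObj.one_mul_assoc]
      simp
    mul_one := by
      rw [← cancel_epi (coequalizer.π a b ▷ 𝟙_ C), MonoidalCategory.whiskerLeft_comp,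
        Category.assoc, ← whisker_exchange_assoc, hm', MonObj.mul_one_assoc]
      simp
    mul_assoc := by
      rw [← cancel_epi ((coequalizer.π a b ⊗ₘ coequalizer.π a b) ⊗ₘ coequalizer.π a b)]
      have h1 : ((coequalizer.π a b ⊗ₘ coequalizer.π a b) ⊗ₘ coequalizer.π a b) ≫ m ▷ _ ≫ m =
          MonObj.mul ▷ T ≫ MonObj.mul ≫ coequalizer.π a b := by
        rw [← tensorHom_id, tensorHom_comp_tensorHom_assoc, hm, Category.comp_id,
          MonoidalCategory.tensorHom_def, comp_whiskerRight, Category.assoc, Category.assoc, hm']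
      have h2 : (coequalizer.π a b ⊗ₘ (coequalizer.π a b ⊗ₘ coequalizer.π a b)) ≫ _ ◁ m ≫ m =
          T ◁ MonObj.mul ≫ MonObj.mul ≫ coequalizer.π a b := by
        rw [← id_tensorHom, tensorHom_comp_tensorHom_assoc, hm, Category.comp_id,
          MonoidalCategory.tensorHom_def', MonoidalCategory.whiskerLeft_comp, Category.assoc,
          Category.assoc, hm'']
      rw [h1, associator_naturality_assoc, h2, MonObj.mul_assoc_assoc] }

lemma isMonHom_quotMonObj_π (ha : s ≫ a = 𝟙 T) (hb : s ≫ b = 𝟙 T) :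
    letI := quotMonObj ha hb
    IsMonHom (coequalizer.π a b) :=
  letI := quotMonObj ha hb
  { one_hom := rfl
    mul_hom := (exists_quotMul ha hb).choose_spec.symm }

lemma isCommMonObj_quotMonObj [IsCommMonObj T] (ha : s ≫ a = 𝟙 T) (hb : s ≫ b = 𝟙 T) :
    letI := quotMonObj ha hb
    IsCommMonObj (coequalizer a b) :=
  letI := quotMonObj ha hb
  { mul_comm := by
      have := isMonHom_quotMonObj_π ha hb
      rw [← cancel_epi (coequalizer.π a b ⊗ₘ coequalizer.π a b),
        BraidedCategory.braiding_naturality_assoc, ← IsMonHom.mul_hom,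
        IsCommMonObj.mul_comm_assoc] }

lemma isMonHom_of_epi_comp {X Y Z : C} [MonObj X] [MonObj Y] [MonObj Z] (q : X ⟶ Y) [IsMonHom q]
    [Epi q] (h : Y ⟶ Z) [IsMonHom (q ≫ h)] : IsMonHom h where
  one_hom := by
    rw [← IsMonHom.one_hom q, Category.assoc, IsMonHom.one_hom (q ≫ h)]
  mul_hom := by
    rw [← cancel_epi (q ⊗ₘ q), ← IsMonHom.mul_hom_assoc, IsMonHom.mul_hom (q ≫ h),
      tensorHom_comp_tensorHom_assoc]

end Quotient

/-! ### Pushouts of commutative monoids as relative tensor products -/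

section Pushout

variable {C : Type u} [Category.{v} C] [MonoidalCategory C] [SymmetricCategory C]
  [HasCoequalizers C] [MonoidalClosed C] {A B A' : CommMon C} (φ : A ⟶ B) (ψ : A ⟶ A')

/-- A commutative monoid as a module over itself. -/
def regMod (A : CommMon C) : ModCat A := Mod.regular A.X

@[simp] lemma act_regMod (A : CommMon C) : act (regMod A) = MonObj.mul := rfl

/-- A commutative `A`-algebra as an `A`-module. -/
abbrev algMod : ModCat A := (restrictScalars ψ).obj (regMod A')

/-- The map `b ⊗ a ⊗ a' ↦ b φ(a) ⊗ a'`. -/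
def pairL (_ψ : A ⟶ A') : (B.X ⊗ A.X) ⊗ A'.X ⟶ B.X ⊗ A'.X := (B.X ◁ homX φ ≫ MonObj.mul) ▷ A'.X

/-- The map `b ⊗ a ⊗ a' ↦ b ⊗ ψ(a) a'`. -/
def pairR (_φ : A ⟶ B) : (B.X ⊗ A.X) ⊗ A'.X ⟶ B.X ⊗ A'.X :=
  (α_ B.X A.X A'.X).hom ≫ B.X ◁ (homX ψ ▷ A'.X ≫ MonObj.mul)

/-- The map `b ⊗ a' ↦ b ⊗ 1 ⊗ a'`. -/
def pairSection (B A A' : CommMon C) : B.X ⊗ A'.X ⟶ (B.X ⊗ A.X) ⊗ A'.X :=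
  ((ρ_ B.X).inv ≫ B.X ◁ MonObj.one) ▷ A'.X

instance : IsMonHom (pairL φ ψ) :=
  inferInstanceAs (IsMonHom ((B.X ◁ homX φ ≫ MonObj.mul) ▷ A'.X))

instance : IsMonHom (pairR ψ φ) :=
  inferInstanceAs (IsMonHom ((α_ B.X A.X A'.X).hom ≫ B.X ◁ (homX ψ ▷ A'.X ≫ MonObj.mul)))

lemma pairSection_pairL : pairSection B A A' ≫ pairL φ ψ = 𝟙 _ := by
  rw [pairSection, pairL, ← comp_whiskerRight, Category.assoc,
    ← MonoidalCategory.whiskerLeft_comp_assoc, IsMonHom.one_hom, MonObj.mul_one]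
  simp

lemma pairSection_pairR : pairSection B A A' ≫ pairR ψ φ = 𝟙 _ := by
  rw [pairSection, pairR, comp_whiskerRight, Category.assoc, associator_naturality_middle_assoc,
    ← MonoidalCategory.whiskerLeft_comp, ← comp_whiskerRight_assoc, IsMonHom.one_hom,
    MonObj.one_mul]
  simp

/-- The tensor product `B ⊗_A A'` of commutative monoids. -/
def pushoutMon : CommMon C :=
  letI := quotMonObj (pairSection_pairL φ ψ) (pairSection_pairR φ ψ)
  haveI := isCommMonObj_quotMonObj (pairSection_pairL φ ψ) (pairSection_pairR φ ψ)
  { X := coequalizer (pairL φ ψ) (pairR ψ φ) }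

/-- The projection `B ⊗ A' ⟶ B ⊗_A A'`. -/
def pushoutπ : B.X ⊗ A'.X ⟶ (pushoutMon φ ψ).X := coequalizer.π (pairL φ ψ) (pairR ψ φ)

instance : Epi (pushoutπ φ ψ) := inferInstanceAs (Epi (coequalizer.π (pairL φ ψ) (pairR ψ φ)))

instance : IsMonHom (pushoutπ φ ψ) :=
  isMonHom_quotMonObj_π (pairSection_pairL φ ψ) (pairSection_pairR φ ψ)

lemma pushoutπ_condition : pairL φ ψ ≫ pushoutπ φ ψ = pairR ψ φ ≫ pushoutπ φ ψ :=
  coequalizer.condition _ _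

instance (M : C) [MonObj M] : IsMonHom (MonObj.one (X := M)) where
  one_hom := Category.id_comp _
  mul_hom := by
    rw [MonoidalCategory.tensorHom_def, Category.assoc, MonObj.mul_one, rightUnitor_naturality,
      ← unitors_equal]
    rfl

/-- The map `b ↦ b ⊗ 1`. -/
def tensorInl (B A' : CommMon C) : B.X ⟶ B.X ⊗ A'.X := (ρ_ B.X).inv ≫ B.X ◁ MonObj.one

/-- The map `a' ↦ 1 ⊗ a'`. -/
def tensorInr (B A' : CommMon C) : A'.X ⟶ B.X ⊗ A'.X := (λ_ A'.X).inv ≫ MonObj.one ▷ A'.X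

instance : IsMonHom (tensorInl B A') :=
  inferInstanceAs (IsMonHom ((ρ_ B.X).inv ≫ B.X ◁ MonObj.one))

instance : IsMonHom (tensorInr B A') :=
  inferInstanceAs (IsMonHom ((λ_ A'.X).inv ≫ MonObj.one ▷ A'.X))

/-- The morphism `B ⟶ B ⊗_A A'`. -/
def pushoutInl : B ⟶ pushoutMon φ ψ :=
  mkMonHom (tensorInl B A' ≫ pushoutπ φ ψ) inferInstance

/-- The morphism `A' ⟶ B ⊗_A A'`. -/
def pushoutInr : A' ⟶ pushoutMon φ ψ :=
  mkMonHom (tensorInr B A' ≫ pushoutπ φ ψ) inferInstance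

lemma homX_pushoutInl : homX (pushoutInl φ ψ) = tensorInl B A' ≫ pushoutπ φ ψ := rfl

lemma homX_pushoutInr : homX (pushoutInr φ ψ) = tensorInr B A' ≫ pushoutπ φ ψ := rfl

/-- The map `b ⊗ a' ↦ β(b) α(a')`. -/
def tensorDesc {R : CommMon C} (β : B ⟶ R) (α : A' ⟶ R) : B.X ⊗ A'.X ⟶ R.X :=
  (homX β ⊗ₘ homX α) ≫ MonObj.mul

instance {R : CommMon C} (β : B ⟶ R) (α : A' ⟶ R) : IsMonHom (tensorDesc β α) :=
  inferInstanceAs (IsMonHom ((homX β ⊗ₘ homX α) ≫ MonObj.mul))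

lemma tensorInl_desc {R : CommMon C} (β : B ⟶ R) (α : A' ⟶ R) :
    tensorInl B A' ≫ tensorDesc β α = homX β := by
  rw [tensorInl, tensorDesc, MonoidalCategory.tensorHom_def', Category.assoc, Category.assoc,
    ← MonoidalCategory.whiskerLeft_comp_assoc, IsMonHom.one_hom, whisker_exchange_assoc,
    MonObj.mul_one]
  simp

lemma tensorInr_desc {R : CommMon C} (β : B ⟶ R) (α : A' ⟶ R) :
    tensorInr B A' ≫ tensorDesc β α = homX α := by
  rw [tensorInr, tensorDesc, MonoidalCategory.tensorHom_def, Category.assoc, Category.assoc,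
    ← comp_whiskerRight_assoc, IsMonHom.one_hom, ← whisker_exchange_assoc, MonObj.one_mul]
  simp

/-- In elements: `(b ⊗ 1)(1 ⊗ a') = b ⊗ a'`. The product on `B ⊗ A'` swaps the two middle factors,
which are units here, and the braiding of the unit with itself is trivial. -/
lemma tensor_eq : (tensorInl B A' ⊗ₘ tensorInr B A') ≫ MonObj.mul = 𝟙 (B.X ⊗ A'.X) := by
  have h : (B.X ◁ MonObj.one (X := A'.X) ⊗ₘ MonObj.one (X := B.X) ▷ A'.X) ≫
      tensorμ B.X A'.X B.X A'.X =
      tensorμ B.X (𝟙_ C) (𝟙_ C) A'.X ≫ (B.X ◁ MonObj.one ⊗ₘ MonObj.one ▷ A'.X) := by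
    rw [← id_tensorHom, ← tensorHom_id, tensorμ_natural, tensorHom_id, id_tensorHom]
  have e : ((ρ_ B.X).inv ⊗ₘ (λ_ A'.X).inv) ≫ tensorμ B.X (𝟙_ C) (𝟙_ C) A'.X =
      (ρ_ B.X).inv ⊗ₘ (λ_ A'.X).inv := by
    have : (β_ (𝟙_ C) (𝟙_ C)).hom = 𝟙 _ := by
      rw [braiding_tensorUnit_left, unitors_equal, Iso.hom_inv_id]
    rw [tensorμ, this]
    simp
  rw [MonObj.tensorObj.mul_def, tensorInl, tensorInr, ← tensorHom_comp_tensorHom_assoc,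
    reassoc_of% h, reassoc_of% e, tensorHom_comp_tensorHom, MonObj.mul_one, MonObj.one_mul]
  simp

/-- A morphism of monoids out of a tensor product is determined by its restrictions. -/
lemma tensor_hom_eq {R : CommMon C} (h : B.X ⊗ A'.X ⟶ R.X) [IsMonHom h] :
    h = ((tensorInl B A' ≫ h) ⊗ₘ (tensorInr B A' ≫ h)) ≫ MonObj.mul := by
  rw [← tensorHom_comp_tensorHom_assoc, ← IsMonHom.mul_hom, reassoc_of% tensor_eq]

/-- Both sides send `b ⊗ a ⊗ a'` to the product of `β(b)`, the common image of `a` in `R`, and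
`α(a')`, bracketed differently. -/
lemma pairL_tensorDesc {R : CommMon C} (β : B ⟶ R) (α : A' ⟶ R) (w : φ ≫ β = ψ ≫ α) :
    pairL φ ψ ≫ tensorDesc β α = pairR ψ φ ≫ tensorDesc β α := by
  have w' : homX φ ≫ homX β = homX ψ ≫ homX α := congrArg homX w
  have h1 : (B.X ◁ homX φ ≫ MonObj.mul) ≫ homX β =
      (homX β ⊗ₘ (homX φ ≫ homX β)) ≫ MonObj.mul := by
    rw [Category.assoc, IsMonHom.mul_hom, ← id_tensorHom, tensorHom_comp_tensorHom_assoc,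
      Category.id_comp]
  have h2 : (homX ψ ▷ A'.X ≫ MonObj.mul) ≫ homX α =
      ((homX ψ ≫ homX α) ⊗ₘ homX α) ≫ MonObj.mul := by
    rw [Category.assoc, IsMonHom.mul_hom, ← tensorHom_id, tensorHom_comp_tensorHom_assoc,
      Category.id_comp]
  rw [pairL, pairR, tensorDesc, ← tensorHom_id, tensorHom_comp_tensorHom_assoc, h1,
    Category.id_comp, Category.assoc, ← id_tensorHom, tensorHom_comp_tensorHom_assoc, h2,
    Category.id_comp, ← w']
  have h3 {X Y Z : C} (x : X ⟶ R.X) (y : Y ⟶ R.X) (z : Z ⟶ R.X) :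
      ((x ⊗ₘ y) ≫ MonObj.mul ⊗ₘ z) ≫ MonObj.mul =
        (α_ X Y Z).hom ≫ (x ⊗ₘ (y ⊗ₘ z) ≫ MonObj.mul) ≫ MonObj.mul := by
    rw [← Category.comp_id z, ← tensorHom_comp_tensorHom_assoc, tensorHom_id, MonObj.mul_assoc,
      associator_naturality_assoc, Category.comp_id, ← id_tensorHom, tensorHom_comp_tensorHom_assoc,
      Category.comp_id]
  exact h3 _ _ _

/-- The morphism out of `B ⊗_A A'` induced by a commutative square. -/
def pushoutDesc {R : CommMon C} (β : B ⟶ R) (α : A' ⟶ R) (w : φ ≫ β = ψ ≫ α) :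
    pushoutMon φ ψ ⟶ R :=
  letI k : (pushoutMon φ ψ).X ⟶ R.X := coequalizer.desc _ (pairL_tensorDesc φ ψ β α w)
  have h : pushoutπ φ ψ ≫ k = tensorDesc β α := coequalizer.π_desc _ _
  haveI : IsMonHom (pushoutπ φ ψ ≫ k) := by rw [h]; infer_instance
  mkMonHom k (isMonHom_of_epi_comp (pushoutπ φ ψ) k)

lemma pushoutπ_desc {R : CommMon C} (β : B ⟶ R) (α : A' ⟶ R) (w : φ ≫ β = ψ ≫ α) :
    pushoutπ φ ψ ≫ homX (pushoutDesc φ ψ β α w) = tensorDesc β α :=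
  coequalizer.π_desc _ _

lemma pushoutMon_condition : φ ≫ pushoutInl φ ψ = ψ ≫ pushoutInr φ ψ := by
  apply homX_injective
  -- The map `a ↦ 1 ⊗ a ⊗ 1`, which `pairL` sends to `φ(a) ⊗ 1` and `pairR` to `1 ⊗ ψ(a)`.
  let i : A.X ⟶ (B.X ⊗ A.X) ⊗ A'.X :=
    (λ_ A.X).inv ≫ MonObj.one ▷ A.X ≫ (ρ_ (B.X ⊗ A.X)).inv ≫ (B.X ⊗ A.X) ◁ MonObj.one
  have hL : i ≫ pairL φ ψ = homX φ ≫ tensorInl B A' := by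
    simp only [i, pairL, tensorInl, Category.assoc]
    rw [whisker_exchange, ← rightUnitor_inv_naturality_assoc, Category.assoc,
      ← whisker_exchange_assoc, MonObj.one_mul_assoc]
    simp
  have hR : i ≫ pairR ψ φ = homX ψ ≫ tensorInr B A' := by
    simp only [i, pairR, tensorInr, Category.assoc]
    have h : A.X ◁ MonObj.one ≫ homX ψ ▷ A'.X ≫ MonObj.mul = (ρ_ A.X).hom ≫ homX ψ := by
      rw [whisker_exchange_assoc, MonObj.mul_one, rightUnitor_naturality]
    rw [rightUnitor_inv_naturality_assoc, ← whisker_exchange_assoc,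
      associator_naturality_left_assoc, ← whisker_exchange, associator_naturality_right_assoc,
      ← MonoidalCategory.whiskerLeft_comp_assoc, h]
    simp
  rw [homX_comp, homX_comp, homX_pushoutInl, homX_pushoutInr, ← Category.assoc, ← hL,
    Category.assoc, pushoutπ_condition, reassoc_of% hR]

/-- Uniqueness holds because `pushoutπ` is epi and a morphism of monoids out of `B ⊗ A'` is
determined on the two factors (`tensor_hom_eq`). -/
lemma isPushout_pushoutMon : IsPushout φ ψ (pushoutInl φ ψ) (pushoutInr φ ψ) where
  w := pushoutMon_condition φ ψ
  isColimit' := ⟨PushoutCocone.IsColimit.mk _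
    (fun s ↦ pushoutDesc φ ψ s.inl s.inr s.condition)
    (fun s ↦ homX_injective (by
      rw [homX_comp, homX_pushoutInl, Category.assoc, pushoutπ_desc, tensorInl_desc]))
    (fun s ↦ homX_injective (by
      rw [homX_comp, homX_pushoutInr, Category.assoc, pushoutπ_desc, tensorInr_desc]))
    (fun s m h1 h2 ↦ homX_injective (by
      rw [← cancel_epi (pushoutπ φ ψ), pushoutπ_desc, tensor_hom_eq (pushoutπ φ ψ ≫ homX m),
        ← Category.assoc, ← homX_pushoutInl, ← Category.assoc, ← homX_pushoutInr, ← homX_comp,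
        ← homX_comp, h1, h2]
      rfl))⟩

instance : HasPushouts (CommMon C) :=
  have (A B A' : CommMon C) (φ : A ⟶ B) (ψ : A ⟶ A') : HasPushout φ ψ :=
    (isPushout_pushoutMon φ ψ).hasPushout
  hasPushouts_of_hasColimit_span _

end Pushout

/-! ### Base change for modules and stability of flatness -/

section BaseChangeModules

variable {C : Type u} [Category.{v} C] [MonoidalCategory C] [SymmetricCategory C]
  [HasCoequalizers C] [MonoidalClosed C] {A B A' : CommMon C} (φ : A ⟶ B) (ψ : A ⟶ A')

lemma mul_assoc_tensorHom {X Y Z R : C} [MonObj R] (x : X ⟶ R) (y : Y ⟶ R) (z : Z ⟶ R) :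
    ((x ⊗ₘ y) ≫ MonObj.mul ⊗ₘ z) ≫ MonObj.mul =
      (α_ X Y Z).hom ≫ (x ⊗ₘ (y ⊗ₘ z) ≫ MonObj.mul) ≫ MonObj.mul := by
  rw [← Category.comp_id z, ← tensorHom_comp_tensorHom_assoc, tensorHom_id, MonObj.mul_assoc,
    associator_naturality_assoc, Category.comp_id, ← id_tensorHom, tensorHom_comp_tensorHom_assoc,
    Category.comp_id]

lemma pushoutπ_eq :
    pushoutπ φ ψ = (homX (pushoutInl φ ψ) ⊗ₘ homX (pushoutInr φ ψ)) ≫ MonObj.mul :=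
  tensor_hom_eq (pushoutπ φ ψ)

/-- In `B ⊗_A A'`, one has `(b ⊗ a) (1 ⊗ a') = b ⊗ a a'`. -/
lemma pushoutπ_mul_inr :
    pushoutπ φ ψ ▷ A'.X ≫ (pushoutMon φ ψ).X ◁ homX (pushoutInr φ ψ) ≫ MonObj.mul =
      (α_ B.X A'.X A'.X).hom ≫ B.X ◁ MonObj.mul ≫ pushoutπ φ ψ := by
  rw [← MonoidalCategory.tensorHom_def_assoc, pushoutπ_eq, mul_assoc_tensorHom, ← IsMonHom.mul_hom,
    ← id_tensorHom, tensorHom_comp_tensorHom_assoc, Category.id_comp]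

variable (M : ModCat A')

/-- The projection `B ⊗ M ⟶ B ⊗_A M` for an `A'`-module `M`. -/
def resπ : B.X ⊗ M.X ⟶ extObj φ ((restrictScalars ψ).obj M) :=
  extπ φ ((restrictScalars ψ).obj M)

instance : Epi (resπ φ ψ M) := inferInstanceAs (Epi (extπ φ ((restrictScalars ψ).obj M)))

lemma resπ_condition : (B.X ◁ homX φ ≫ MonObj.mul) ▷ M.X ≫ resπ φ ψ M =
    (α_ B.X A.X M.X).hom ≫ B.X ◁ (homX ψ ▷ M.X ≫ act M) ≫ resπ φ ψ M :=
  (extπ_condition φ ((restrictScalars ψ).obj M)).trans (Category.assoc _ _ _)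

/-- Descent along the projection `B ⊗ M ⟶ B ⊗_A M`. -/
def resDesc {W : C} (h : B.X ⊗ M.X ⟶ W) (w : (B.X ◁ homX φ ≫ MonObj.mul) ▷ M.X ≫ h =
    (α_ B.X A.X M.X).hom ≫ B.X ◁ (homX ψ ▷ M.X ≫ act M) ≫ h) :
    extObj φ ((restrictScalars ψ).obj M) ⟶ W :=
  coequalizer.desc h (w.trans (Category.assoc _ _ _).symm)

lemma resπ_desc {W : C} (h : B.X ⊗ M.X ⟶ W) (w : (B.X ◁ homX φ ≫ MonObj.mul) ▷ M.X ≫ h =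
    (α_ B.X A.X M.X).hom ≫ B.X ◁ (homX ψ ▷ M.X ≫ act M) ≫ h) :
    resπ φ ψ M ≫ resDesc φ ψ M h w = h := coequalizer.π_desc _ _

lemma whiskerLeft_resπ_extAct :
    B.X ◁ resπ φ ψ M ≫ extAct φ ((restrictScalars ψ).obj M) =
      (α_ B.X B.X M.X).inv ≫ MonObj.mul ▷ M.X ≫ resπ φ ψ M :=
  extπ_extAct φ _

/-- Descent along the projection `B ⊗ M ⟶ B ⊗_A M`, for `A`-modules. -/
def modDesc (φ : A ⟶ B) (M : ModCat A) {W : C} (h : B.X ⊗ M.X ⟶ W)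
    (w : extL φ M ≫ h = extR B M ≫ h) : extObj φ M ⟶ W :=
  coequalizer.desc h w

lemma extπ_modDesc (φ : A ⟶ B) (M : ModCat A) {W : C} (h : B.X ⊗ M.X ⟶ W)
    (w : extL φ M ≫ h = extR B M ≫ h) : extπ φ M ≫ modDesc φ M h w = h :=
  coequalizer.π_desc _ _

/-- In elements: `(b ⊗ a') ⊗ m = (b ⊗ 1) ⊗ a' m`, since `b ⊗ a'` is the product of `b ⊗ 1` and the
image of `a'`. -/
lemma whiskerRight_pushoutπ_extπ :
    pushoutπ φ ψ ▷ M.X ≫ extπ (pushoutInr φ ψ) M =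
      (α_ B.X A'.X M.X).hom ≫ B.X ◁ act M ≫ homX (pushoutInl φ ψ) ▷ M.X ≫
        extπ (pushoutInr φ ψ) M := by
  have h : pushoutπ φ ψ ▷ M.X =
      (homX (pushoutInl φ ψ) ▷ A'.X) ▷ M.X ≫ extL (pushoutInr φ ψ) M := by
    rw [extL, ← comp_whiskerRight, ← MonoidalCategory.tensorHom_def_assoc, ← pushoutπ_eq]
  rw [h, Category.assoc, extπ_condition, extR, Category.assoc, associator_naturality_left_assoc,
    ← whisker_exchange_assoc]

/-- The map `B ⊗_A M ⟶ (B ⊗_A A') ⊗_{A'} M`, `b ⊗ m ↦ (b ⊗ 1) ⊗ m`. -/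
def baseChangeHom : extObj φ ((restrictScalars ψ).obj M) ⟶ extObj (pushoutInr φ ψ) M :=
  resDesc φ ψ M (homX (pushoutInl φ ψ) ▷ M.X ≫ extπ (pushoutInr φ ψ) M) (by
    have h : (B.X ◁ homX φ ≫ MonObj.mul) ≫ homX (pushoutInl φ ψ) =
        B.X ◁ homX ψ ≫ pushoutπ φ ψ := by
      have w : homX φ ≫ homX (pushoutInl φ ψ) = homX ψ ≫ homX (pushoutInr φ ψ) :=
        congrArg homX (pushoutMon_condition φ ψ)
      rw [pushoutπ_eq, Category.assoc, IsMonHom.mul_hom, ← id_tensorHom, ← id_tensorHom,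
        tensorHom_comp_tensorHom_assoc, tensorHom_comp_tensorHom_assoc, w]
    rw [← comp_whiskerRight_assoc, h, comp_whiskerRight_assoc, whiskerRight_pushoutπ_extπ]
    simp)

lemma resπ_baseChangeHom : resπ φ ψ M ≫ baseChangeHom φ ψ M =
    homX (pushoutInl φ ψ) ▷ M.X ≫ extπ (pushoutInr φ ψ) M :=
  resπ_desc _ _ _ _ _

/-- The inverse on representatives is `(b ⊗ a') ⊗ m ↦ b ⊗ a' m`. It descends because `b φ(a) ⊗ a' m
= b ⊗ ψ(a)(a' m) = b ⊗ (ψ(a) a') m`. -/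
lemma exists_baseChangeInv :
    ∃ k : (pushoutMon φ ψ).X ⊗ M.X ⟶ extObj φ ((restrictScalars ψ).obj M),
      pushoutπ φ ψ ▷ M.X ≫ k = (α_ B.X A'.X M.X).hom ≫ B.X ◁ act M ≫ resπ φ ψ M := by
  refine exists_desc_right (pairL φ ψ) (pairR ψ φ) _ ?_
  have h := resπ_condition φ ψ M
  rw [pairL, pairR]
  simp only [comp_whiskerRight, MonoidalCategory.whiskerLeft_comp, Category.assoc] at h ⊢
  rw [associator_naturality_left_assoc, ← whisker_exchange_assoc]
  have e : (B.X ◁ homX φ) ▷ A'.X ▷ M.X ≫ (α_ (B.X ⊗ B.X) A'.X M.X).hom ≫ _ ◁ act M =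
    (α_ _ _ _).hom ≫ (B.X ⊗ A.X) ◁ act M ≫ (B.X ◁ homX φ) ▷ M.X := by
    rw [associator_naturality_left_assoc, ← whisker_exchange]
  rw [reassoc_of% e, h]
  have m := mul_act M
  have m' : B.X ◁ MonObj.mul ▷ M.X ≫ B.X ◁ act M =
      B.X ◁ ((α_ A'.X A'.X M.X).hom ≫ A'.X ◁ act M ≫ act M) := by
    rw [← m, MonoidalCategory.whiskerLeft_comp]
  rw [associator_naturality_middle_assoc, reassoc_of% m']
  have e' : B.X ◁ homX ψ ▷ A'.X ▷ M.X ≫ B.X ◁ (α_ A'.X A'.X M.X).hom ≫ B.X ◁ A'.X ◁ act M =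
      B.X ◁ (α_ A.X A'.X M.X).hom ≫ B.X ◁ A.X ◁ act M ≫ B.X ◁ homX ψ ▷ M.X := by
    simp only [← MonoidalCategory.whiskerLeft_comp]
    rw [associator_naturality_left_assoc, ← whisker_exchange]
  simp only [MonoidalCategory.whiskerLeft_comp, Category.assoc, associator_naturality_middle_assoc,
    reassoc_of% e', tensor_whiskerLeft, Iso.inv_hom_id_assoc, pentagon_assoc]

/-- The inverse of `baseChangeHom`. -/
def baseChangeInv : extObj (pushoutInr φ ψ) M ⟶ extObj φ ((restrictScalars ψ).obj M) :=
  modDesc _ _ (exists_baseChangeInv φ ψ M).choose (by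
    have h := (exists_baseChangeInv φ ψ M).choose_spec
    -- Balancedness over `A'` is checked on `b ⊗ a' ⊗ a'' ⊗ m`: both sides give `b ⊗ a' a'' m`.
    rw [← cancel_epi (pushoutπ φ ψ ▷ A'.X ▷ M.X), extL, ← comp_whiskerRight_assoc,
      pushoutπ_mul_inr, extR, Category.assoc, associator_naturality_left_assoc,
      ← whisker_exchange_assoc, h, comp_whiskerRight_assoc, comp_whiskerRight_assoc, h]
    have m := mul_act M
    have m' : B.X ◁ MonObj.mul ▷ M.X ≫ B.X ◁ act M =
        B.X ◁ ((α_ A'.X A'.X M.X).hom ≫ A'.X ◁ act M ≫ act M) := by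
      rw [← m, MonoidalCategory.whiskerLeft_comp]
    rw [associator_naturality_middle_assoc, reassoc_of% m']
    simp)

lemma whiskerRight_pushoutπ_extπ_baseChangeInv :
    pushoutπ φ ψ ▷ M.X ≫ extπ (pushoutInr φ ψ) M ≫ baseChangeInv φ ψ M =
      (α_ B.X A'.X M.X).hom ≫ B.X ◁ act M ≫ resπ φ ψ M := by
  rw [baseChangeInv, extπ_modDesc, (exists_baseChangeInv φ ψ M).choose_spec]

instance : IsIso (baseChangeHom φ ψ M) := by
  refine ⟨baseChangeInv φ ψ M, ?_, ?_⟩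
  · rw [← cancel_epi (resπ φ ψ M), reassoc_of% resπ_baseChangeHom φ ψ M, homX_pushoutInl,
      comp_whiskerRight_assoc, whiskerRight_pushoutπ_extπ_baseChangeInv, tensorInl,
      comp_whiskerRight_assoc, associator_naturality_middle_assoc,
      ← MonoidalCategory.whiskerLeft_comp_assoc, one_act]
    simp
  · rw [← cancel_epi (extπ (pushoutInr φ ψ) M), ← cancel_epi (pushoutπ φ ψ ▷ M.X),
      reassoc_of% whiskerRight_pushoutπ_extπ_baseChangeInv φ ψ M, resπ_baseChangeHom,
      Category.comp_id, whiskerRight_pushoutπ_extπ]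

/-- The morphism `B ⊗_A M ⟶ (B ⊗_A A') ⊗_{A'} M` of `B`-modules. -/
def baseChangeModHom : (extendScalars φ).obj ((restrictScalars ψ).obj M) ⟶
    (restrictScalars (pushoutInl φ ψ)).obj ((extendScalars (pushoutInr φ ψ)).obj M) :=
  mkHom (baseChangeHom φ ψ M) (by
    refine (?_ : extAct φ _ ≫ baseChangeHom φ ψ M =
      B.X ◁ baseChangeHom φ ψ M ≫ homX (pushoutInl φ ψ) ▷ _ ≫ extAct (pushoutInr φ ψ) M)
    rw [← cancel_epi (B.X ◁ resπ φ ψ M), reassoc_of% whiskerLeft_resπ_extAct,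
      ← MonoidalCategory.whiskerLeft_comp_assoc, resπ_baseChangeHom,
      MonoidalCategory.whiskerLeft_comp_assoc, whisker_exchange_assoc, extπ_extAct,
      ← comp_whiskerRight_assoc, IsMonHom.mul_hom]
    simp [MonoidalCategory.tensorHom_def'])

/-- Extension of scalars commutes with base change. -/
def baseChangeIso : restrictScalars ψ ⋙ extendScalars φ ≅
    extendScalars (pushoutInr φ ψ) ⋙ restrictScalars (pushoutInl φ ψ) :=
  NatIso.ofComponents
    (fun M ↦
      haveI : IsIso (baseChangeModHom φ ψ M).hom := inferInstanceAs (IsIso (baseChangeHom φ ψ M))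
      haveI := isIso_of_hom (baseChangeModHom φ ψ M)
      asIso (baseChangeModHom φ ψ M))
    (fun {M N} h ↦ by
      ext
      refine (?_ : extMap φ ((restrictScalars ψ).map h) ≫ baseChangeHom φ ψ N =
        baseChangeHom φ ψ M ≫ extMap (pushoutInr φ ψ) h)
      have e : resπ φ ψ M ≫ extMap φ ((restrictScalars ψ).map h) = B.X ◁ h.hom ≫ resπ φ ψ N :=
        extπ_extMap φ _
      rw [← cancel_epi (resπ φ ψ M), reassoc_of% e, resπ_baseChangeHom,
        reassoc_of% resπ_baseChangeHom φ ψ M, extπ_extMap, whisker_exchange_assoc])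

variable {φ} in
-- By `baseChangeIso`, extension along the pushout followed by restriction to `B` is restriction to
-- `A` followed by `B ⊗_A -`, which preserves finite limits. Restriction is conservative and
-- preserves limits, so it reflects them.
lemma IsFlat.pushoutInr [HasFiniteLimits C] (h : IsFlat φ) : IsFlat (pushoutInr φ ψ) := by
  have : PreservesFiniteLimits (extendScalars φ) := h
  refine ⟨fun J _ _ ↦ ?_⟩
  have : PreservesLimitsOfShape J
      (extendScalars (RelSch.pushoutInr φ ψ) ⋙ restrictScalars (pushoutInl φ ψ)) :=
    preservesLimitsOfShape_of_natIso (baseChangeIso φ ψ)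
  have : ReflectsLimitsOfShape J (restrictScalars (pushoutInl φ ψ)) :=
    reflectsLimitsOfShape_of_reflectsIsomorphisms
  exact preservesLimitsOfShape_of_reflects_of_preserves _ (restrictScalars (pushoutInl φ ψ))

/-- This is the step that carries joint conservativity along a base change: an isomorphism after
extension to `B ⊗_A A'` gives one over `B` for the underlying `A`-modules. -/
lemma isIso_extendScalars_of_isIso_pushoutInr {M N : ModCat A'} (h : M ⟶ N)
    [IsIso ((extendScalars (pushoutInr φ ψ)).map h)] :
    IsIso ((extendScalars φ).map ((restrictScalars ψ).map h)) := by
  have : IsIso ((extendScalars (pushoutInr φ ψ) ⋙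
    restrictScalars (pushoutInl φ ψ)).map h) := by dsimp; infer_instance
  exact (NatIso.isIso_map_iff (baseChangeIso φ ψ) h).2 this

variable {P : CommMon C} {i : B ⟶ P} {j : A' ⟶ P}

variable {φ ψ} in
lemma IsFlat.of_isPushout [HasFiniteLimits C] (sq : IsPushout φ ψ i j) (h : IsFlat φ) :
    IsFlat j := by
  rw [← (isPushout_pushoutMon φ ψ).inr_isoIsPushout_hom _ _ sq]
  exact (h.pushoutInr ψ).comp (isFlat_of_isIso _)

variable {φ ψ} in
lemma isIso_extendScalars_of_isPushout (sq : IsPushout φ ψ i j) {M N : ModCat A'} (h : M ⟶ N)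
    [IsIso ((extendScalars j).map h)] :
    IsIso ((extendScalars φ).map ((restrictScalars ψ).map h)) := by
  let e := (isPushout_pushoutMon φ ψ).isoIsPushout _ _ sq
  have he : j ≫ e.inv = pushoutInr φ ψ := (isPushout_pushoutMon φ ψ).inr_isoIsPushout_inv _ _ sq
  have : IsIso ((extendScalars j ⋙ extendScalars e.inv).map h) := by dsimp; infer_instance
  have : IsIso ((extendScalars (pushoutInr φ ψ)).map h) := by
    rw [← he]
    exact (NatIso.isIso_map_iff (extendComp j e.inv) h).2 this
  exact isIso_extendScalars_of_isIso_pushoutInr φ ψ h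

end BaseChangeModules

/-! ### Finite presentation of epimorphisms as a lifting property -/

section FinitePresentation

variable {C : Type u} [Category.{v} C] [MonoidalCategory C] [SymmetricCategory C]
  {A B E : CommMon C}

/-- Lifting of morphisms to the stages of a filtered colimit; for epimorphisms this is finite
presentation. -/
def LiftsToStage (φ : A ⟶ B) : Prop :=
  ∀ ⦃J : Type v⦄ [SmallCategory J] [IsFiltered J] (F : J ⥤ CommMon C) (c : Cocone F)
    (_ : IsColimit c) (s : (Functor.const J).obj A ⟶ F) (f : B ⟶ c.pt)
    (_ : ∀ j, s.app j ≫ c.ι.app j = φ ≫ f), ∃ (j : J) (q : B ⟶ F.obj j), φ ≫ q = s.app j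

lemma IsOfFinitePresentation.liftsToStage {φ : A ⟶ B} (h : IsOfFinitePresentation φ) :
    LiftsToStage φ := by
  intro J _ _ F c hc s f w
  have : IsFinitelyPresentable.{v} (Under.mk φ) :=
    isFinitelyPresentable_iff_preservesFilteredColimitsOfSize.2 h
  obtain ⟨j, q, hq, -⟩ := IsFinitelyPresentable.exists_hom_of_isColimit_under hc φ s f w
  exact ⟨j, q, hq⟩

/-- For `φ` epi, each set `Hom_A(B, -)` has at most one element. Commutation with filtered colimits
thus reduces to the existence of a lift to some stage. -/
lemma LiftsToStage.isOfFinitePresentation {φ : A ⟶ B} [Epi φ] (h : LiftsToStage φ) :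
    IsOfFinitePresentation φ := by
  have hs (X : Under A) : Subsingleton (Under.mk φ ⟶ X) := ⟨fun a b ↦ by
    ext1
    exact (cancel_epi φ).1 ((Under.w a).trans (Under.w b).symm)⟩
  refine ⟨fun J _ _ ↦ ⟨fun {F} ↦ ⟨fun {c} hc ↦ ⟨Types.FilteredColimit.isColimitOf _ _ ?_ ?_⟩⟩⟩⟩
  · intro (x : Under.mk φ ⟶ c.pt)
    obtain ⟨j, q, hq⟩ := h (F ⋙ Under.forget A) ((Under.forget A).mapCocone c)
      (isColimitOfPreserves _ hc)
      { app := fun j ↦ (F.obj j).hom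
        naturality := fun _ _ g ↦ (Category.id_comp _).trans (Under.w (F.map g)).symm }
      x.right (fun j ↦ (Under.w (c.ι.app j)).trans (Under.w x).symm)
    exact ⟨j, Under.homMk q hq, (hs _).elim _ _⟩
  · intro i j x y _
    exact ⟨IsFiltered.max i j, IsFiltered.leftToMax i j, IsFiltered.rightToMax i j,
      (hs _).elim _ _⟩

lemma LiftsToStage.of_isIso (φ : A ⟶ B) [IsIso φ] : LiftsToStage φ := fun J _ _ F c _ s _ _ ↦ by
  obtain ⟨j⟩ := IsFiltered.nonempty (C := J)
  exact ⟨j, inv φ ≫ s.app j, by simp⟩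

/-- A lift of `B` to a stage `j` makes the diagram beyond `j` a diagram under `B`, to which the
property of `ψ` applies. The category under `j` is final in the filtered category `J`, so the
colimit is unchanged. -/
lemma LiftsToStage.comp {φ : A ⟶ B} [Epi φ] {ψ : B ⟶ E} (hφ : LiftsToStage φ)
    (hψ : LiftsToStage ψ) : LiftsToStage (φ ≫ ψ) := by
  intro J _ _ F c hc s f w
  obtain ⟨j, q, hq⟩ := hφ F c hc s (ψ ≫ f) (fun j ↦ (w j).trans (Category.assoc _ _ _))
  obtain ⟨x, r, hr⟩ := hψ (Under.forget j ⋙ F) (c.whisker (Under.forget j))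
    ((Functor.Final.isColimitWhiskerEquiv (Under.forget j) c).symm hc)
    { app := fun x ↦ q ≫ F.map x.hom
      naturality := fun x y g ↦ by
        refine (Category.id_comp _).trans ?_
        have : F.map x.hom ≫ F.map g.right = F.map y.hom := by
          rw [← F.map_comp, Under.w g]
        exact ((Category.assoc _ _ _).trans (congrArg (q ≫ ·) this)).symm }
    f (fun x ↦ by
      -- The two maps from `B` to the colimit agree because they agree on `A` and `φ` is epi.
      rw [← cancel_epi φ]
      have e : F.map x.hom ≫ c.ι.app x.right = c.ι.app j := c.w x.hom
      refine Eq.trans (?_ : _ = φ ≫ (q ≫ F.map x.hom) ≫ c.ι.app x.right) ?_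
      · rfl
      rw [Category.assoc, e, reassoc_of% hq, w, Category.assoc])
  refine ⟨x.right, r, ?_⟩
  have n : s.app j ≫ F.map x.hom = s.app x.right := by
    rw [← s.naturality]
    exact Category.id_comp _
  have hr' : ψ ≫ r = q ≫ F.map x.hom := hr
  refine (Category.assoc φ ψ r).trans ((congrArg (φ ≫ ·) hr').trans ?_)
  exact ((Category.assoc _ _ _).symm.trans (congrArg (· ≫ F.map x.hom) hq)).trans n

lemma LiftsToStage.of_isPushout {A' P : CommMon C} {φ : A ⟶ B} {ψ : A ⟶ A'} {i : B ⟶ P}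
    {j : A' ⟶ P} (sq : IsPushout φ ψ i j) (h : LiftsToStage φ) : LiftsToStage j := by
  intro J _ _ F c hc s f w
  obtain ⟨k, q, hq⟩ := h F c hc ((Functor.const J).map ψ ≫ s) (i ≫ f) (fun k ↦ by
    have := w k
    rw [NatTrans.comp_app, Category.assoc, this, ← Category.assoc, ← Category.assoc, sq.w]
    rfl)
  exact ⟨k, sq.desc q (s.app k) hq, sq.inr_desc _ _ _⟩

/-- The lifting problem is transposed to `C`, where `R` turns the filtered colimit into a filtered
colimit, and the solution is transposed back. -/
lemma LiftsToStage.map_leftAdjoint {D : Type u} [Category.{v} D] [MonoidalCategory D]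
    [SymmetricCategory D] {L : CommMon C ⥤ CommMon D} {R : CommMon D ⥤ CommMon C} (adj : L ⊣ R)
    [PreservesFilteredColimitsOfSize.{v, v} R] {φ : A ⟶ B} (h : LiftsToStage φ) :
    LiftsToStage (L.map φ) := by
  intro J _ _ F c hc s f w
  obtain ⟨k, q, hq⟩ := h (F ⋙ R) (R.mapCocone c) (isColimitOfPreserves R hc)
    { app := fun j ↦ adj.homEquiv _ _ (s.app j)
      naturality := fun i j g ↦ by
        have e : s.app i ≫ F.map g = s.app j := by
          rw [← s.naturality]
          exact Category.id_comp _
        refine (Category.id_comp _).trans ?_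
        refine Eq.trans ?_ (adj.homEquiv_naturality_right (s.app i) (F.map g))
        rw [e]
        rfl }
    (adj.homEquiv _ _ f) (fun j ↦ by
      refine (adj.homEquiv_naturality_right (s.app j) (c.ι.app j)).symm.trans ?_
      rw [w j, adj.homEquiv_naturality_left]
      rfl)
  refine ⟨k, (adj.homEquiv _ _).symm q, ?_⟩
  rw [← adj.homEquiv_naturality_left_symm, hq]
  exact Equiv.symm_apply_apply _ _

end FinitePresentation

/-! ### Zariski open immersions and coverings form a pretopology -/

section ZariskiOpen

variable {C : Type u} [Category.{v} C] [MonoidalCategory C] [SymmetricCategory C]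
  [HasCoequalizers C] [MonoidalClosed C]

lemma isZariskiOpen_of_isIso {X Y : Aff C} (p : Y ⟶ X) [IsIso p] : IsZariskiOpen p where
  flat := isFlat_of_isIso p.unop
  epi := inferInstance
  finitePresentation := (LiftsToStage.of_isIso p.unop).isOfFinitePresentation

lemma IsZariskiOpen.comp {X Y Z : Aff C} {p : Z ⟶ Y} {q : Y ⟶ X} (hp : IsZariskiOpen p)
    (hq : IsZariskiOpen q) : IsZariskiOpen (p ≫ q) where
  flat := hq.flat.comp hp.flat
  epi := by
    have := hp.epi
    have := hq.epi
    exact epi_comp q.unop p.unop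
  finitePresentation := by
    have := hp.epi
    have := hq.epi
    have : Epi (p ≫ q).unop := epi_comp q.unop p.unop
    exact (hq.finitePresentation.liftsToStage.comp
      hp.finitePresentation.liftsToStage).isOfFinitePresentation

lemma IsZariskiOpen.of_isPullback [HasFiniteLimits C] {X Y S P : Aff C} {p₁ : P ⟶ Y} {p₂ : P ⟶ X}
    {g : Y ⟶ S} {f : X ⟶ S} (sq : IsPullback p₁ p₂ g f) (hf : IsZariskiOpen f) :
    IsZariskiOpen p₁ := by
  have sq' : IsPushout f.unop g.unop p₂.unop p₁.unop := sq.unop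
  have := hf.epi
  have : Epi p₁.unop := ⟨fun a b h ↦ sq'.hom_ext (by
    rw [← cancel_epi f.unop, sq'.w_assoc, sq'.w_assoc, h]) h⟩
  exact ⟨hf.flat.of_isPushout sq', this,
    (hf.finitePresentation.liftsToStage.of_isPushout sq').isOfFinitePresentation⟩

/-- A family of functors of extension of scalars is jointly conservative. -/
def Conservative {ι : Type*} {S : Aff C} {X : ι → Aff C} (f : ∀ i, X i ⟶ S) : Prop :=
  ∀ ⦃M N : ModCat S.unop⦄ (h : M ⟶ N), (∀ i, IsIso ((extendScalars (f i).unop).map h)) → IsIso h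

lemma Conservative.jointlyReflectIsomorphisms {ι : Type*} {S : Aff C} {X : ι → Aff C}
    {f : ∀ i, X i ⟶ S} (h : Conservative f) :
    JointlyReflectIsomorphisms (fun i ↦ extendScalars (f i).unop) :=
  ⟨fun k hk ↦ h k hk⟩

lemma Conservative.of_surjective {ι κ : Type*} {S : Aff C} {X : ι → Aff C} {f : ∀ i, X i ⟶ S}
    (h : Conservative f) (e : κ → ι) (he : Function.Surjective e) :
    Conservative (fun k ↦ f (e k)) := fun M N a ha ↦ h a fun i ↦ by
  obtain ⟨k, rfl⟩ := he i
  exact ha k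

/-- Restriction of scalars to `S` is conservative, and the restricted morphism becomes invertible
over each `X i` by base change. -/
lemma Conservative.of_isPullback {ι : Type*} {S Y : Aff C} {X P : ι → Aff C} {f : ∀ i, X i ⟶ S}
    {g : Y ⟶ S} {p₁ : ∀ i, P i ⟶ Y} {p₂ : ∀ i, P i ⟶ X i}
    (sq : ∀ i, IsPullback (p₁ i) (p₂ i) g (f i)) (h : Conservative f) : Conservative p₁ := by
  intro M N a ha
  have : IsIso ((restrictScalars g.unop).map a) := h _ fun i ↦ by
    have := ha i
    exact isIso_extendScalars_of_isPushout (sq i).unop a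
  exact isIso_of_reflects_iso a (restrictScalars g.unop)

lemma Conservative.comp {ι : Type*} {σ : ι → Type*} {S : Aff C} {X : ι → Aff C}
    {Y : ∀ i, σ i → Aff C} {f : ∀ i, X i ⟶ S} {g : ∀ i j, Y i j ⟶ X i} (hf : Conservative f)
    (hg : ∀ i, Conservative (g i)) :
    Conservative (fun p : Σ i, σ i ↦ g p.1 p.2 ≫ f p.1) := by
  refine fun M N a ha ↦ hf a fun i ↦ hg i _ fun j ↦ ?_
  have : IsIso ((extendScalars ((f i).unop ≫ (g i j).unop)).map a) := ha ⟨i, j⟩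
  exact (NatIso.isIso_map_iff (extendComp (f i).unop (g i j).unop) a).1 this

lemma conservative_of_isIso {ι : Type*} [Nonempty ι] {S : Aff C} {X : ι → Aff C}
    (f : ∀ i, X i ⟶ S) [∀ i, IsIso (f i)] : Conservative f := fun M N a ha ↦ by
  obtain ⟨i⟩ := ‹Nonempty ι›
  have := ha i
  have := isEquivalence_extendScalars (f i).unop
  exact isIso_of_reflects_iso a (extendScalars (f i).unop)

lemma mem_zariskiPrecoverage_ofArrows_iff {ι : Type*} {S : Aff C} {X : ι → Aff C}
    (f : ∀ i, X i ⟶ S) : Presieve.ofArrows X f ∈ zariskiPrecoverage C S ↔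
      (∀ i, IsZariskiOpen (f i)) ∧ ∃ (n : ℕ) (e : Fin n → ι), Conservative (fun j ↦ f (e j)) := by
  constructor
  · rintro ⟨⟨-, n, Y, p, hp, hc⟩, ho⟩
    refine ⟨fun i ↦ ho _ ⟨i⟩, n, ?_⟩
    have aux : ∀ ⦃Z : Aff C⦄ (q : Z ⟶ S), Presieve.ofArrows X f q →
        ∃ i, (⟨Z, q⟩ : Σ Z, Z ⟶ S) = ⟨X i, f i⟩ := by
      rintro _ _ ⟨i⟩
      exact ⟨i, rfl⟩
    have (j : Fin n) := aux (p j) (hp j)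
    choose e he using this
    refine ⟨e, fun M N a ha ↦ ?_⟩
    have (j : Fin n) : IsIso ((extendScalars (p j).unop).map a) := by
      -- `p j` equals `f (e j)` only as an arrow with varying source, so invertibility is
      -- transported along an equality in the sigma type.
      let Q (z : Σ Z, Z ⟶ S) : Prop := IsIso ((extendScalars z.2.unop).map a)
      exact (he j ▸ (ha j : Q ⟨_, f (e j)⟩) : Q ⟨Y j, p j⟩)
    exact hc.isIso a
  · rintro ⟨ho, n, e, hc⟩
    exact ⟨⟨fun _ _ ⟨i⟩ ↦ (ho i).flat, n, _, fun j ↦ f (e j), fun j ↦ ⟨e j⟩,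
      hc.jointlyReflectIsomorphisms⟩, fun _ _ ⟨i⟩ ↦ ho i⟩

instance : (zariskiPrecoverage C).HasIsos where
  mem_coverings_of_isIso {S T} f _ := by
    rw [← Presieve.ofArrows_pUnit.{0}, mem_zariskiPrecoverage_ofArrows_iff]
    exact ⟨fun _ ↦ isZariskiOpen_of_isIso f, 1, fun _ ↦ ⟨⟩, conservative_of_isIso _⟩

lemma comp_mem_zariskiPrecoverage {ι : Type*} {S : Aff C} {X : ι → Aff C} (f : ∀ i, X i ⟶ S)
    (hf : Presieve.ofArrows X f ∈ zariskiPrecoverage C S) {σ : ι → Type*}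
    {Y : ∀ i, σ i → Aff C} (g : ∀ i j, Y i j ⟶ X i)
    (hg : ∀ i, Presieve.ofArrows (Y i) (g i) ∈ zariskiPrecoverage C (X i)) :
    Presieve.ofArrows (fun p : Σ i, σ i ↦ Y p.1 p.2) (fun p ↦ g p.1 p.2 ≫ f p.1) ∈
      zariskiPrecoverage C S := by
  rw [mem_zariskiPrecoverage_ofArrows_iff] at hf ⊢
  have hg' := fun i ↦ (mem_zariskiPrecoverage_ofArrows_iff _).1 (hg i)
  refine ⟨fun p ↦ ((hg' p.1).1 p.2).comp (hf.1 p.1), ?_⟩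
  obtain ⟨-, n, e, he⟩ := hf
  choose m d hd using fun i ↦ (hg' i).2
  have h := he.comp (g := fun j k ↦ g (e j) (d (e j) k)) (fun j ↦ hd (e j))
  -- The finite subfamilies over the selected members of the outer covering form a finite set,
  -- renumbered by some `Fin`.
  let t := (Finite.equivFin (Σ j, Fin (m (e j)))).symm
  let r (q : Σ j, Fin (m (e j))) : Σ i, σ i := ⟨e q.1, d _ q.2⟩
  exact ⟨_, fun k ↦ r (t k), h.of_surjective t t.surjective⟩

instance : (zariskiPrecoverage C).IsStableUnderComposition where
  comp_mem_coverings f hf _ _ g hg := comp_mem_zariskiPrecoverage f hf g hg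

instance [HasFiniteLimits C] : (zariskiPrecoverage C).IsStableUnderBaseChange where
  mem_coverings_of_isPullback {ι S X} f hf {Y} g {P} p₁ p₂ sq := by
    simp only [mem_zariskiPrecoverage_ofArrows_iff] at hf ⊢
    obtain ⟨ho, n, e, he⟩ := hf
    exact ⟨fun i ↦ (ho i).of_isPullback (sq i), n, e, he.of_isPullback fun j ↦ sq (e j)⟩

/-- As the coverings are stable under composition and base change, a sieve covers as soon as it
contains one of them, and the finite conservative subfamily of a covering is itself a covering. -/
lemma mem_zariskiTopology_iff [HasFiniteLimits C] {X : Aff C} {S : Sieve X} :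
    S ∈ zariskiTopology C X ↔ ∃ (n : ℕ) (Y : Fin n → Aff C) (p : ∀ j, Y j ⟶ X),
      (∀ j, IsZariskiOpen (p j)) ∧ Conservative p ∧ ∀ j, S (p j) := by
  rw [zariskiTopology, Precoverage.mem_toGrothendieck_iff_of_isStableUnderComposition]
  constructor
  · rintro ⟨R, hR, hle⟩
    obtain ⟨ι, Z, q, rfl⟩ := R.exists_eq_ofArrows
    rw [mem_zariskiPrecoverage_ofArrows_iff] at hR
    obtain ⟨ho, n, e, he⟩ := hR
    exact ⟨n, _, fun j ↦ q (e j), fun j ↦ ho _, he, fun j ↦ hle _ _ ⟨e j⟩⟩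
  · rintro ⟨n, Y, p, ho, hc, hS⟩
    refine ⟨Presieve.ofArrows Y p, (mem_zariskiPrecoverage_ofArrows_iff p).2 ⟨ho, n, id, hc⟩, ?_⟩
    rintro _ _ ⟨j⟩
    exact hS j

end ZariskiOpen

/-! ### Descent along a finite conservative family of left exact left adjoints -/

section AbstractDescent

variable {𝒜 : Type*} [Category* 𝒜] [HasFiniteProducts 𝒜] [HasEqualizers 𝒜] {n : ℕ}
  {ℬ : Fin n → Type*} [∀ j, Category* (ℬ j)] {L : ∀ j, 𝒜 ⥤ ℬ j} {R : ∀ j, ℬ j ⥤ 𝒜}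
  (adj : ∀ j, L j ⊣ R j) (M : 𝒜)

/-- The first map `∏ R_i L_i M ⟶ ∏ R_j L_j R_i L_i M` of descent. -/
def descentFst : (∏ᶜ fun j ↦ (R j).obj ((L j).obj M)) ⟶
    ∏ᶜ fun p : Fin n × Fin n ↦ (R p.2).obj ((L p.2).obj ((R p.1).obj ((L p.1).obj M))) :=
  Pi.lift fun p ↦ Pi.π _ p.1 ≫ (adj p.2).unit.app _

/-- The second map `∏ R_i L_i M ⟶ ∏ R_j L_j R_i L_i M` of descent. -/
def descentSnd : (∏ᶜ fun j ↦ (R j).obj ((L j).obj M)) ⟶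
    ∏ᶜ fun p : Fin n × Fin n ↦ (R p.2).obj ((L p.2).obj ((R p.1).obj ((L p.1).obj M))) :=
  Pi.lift fun p ↦ Pi.π _ p.2 ≫ (R p.2).map ((L p.2).map ((adj p.1).unit.app M))

/-- The comparison from `M` to the object of descent data. -/
def descentHom : M ⟶ equalizer (descentFst adj M) (descentSnd adj M) :=
  equalizer.lift (Pi.lift fun j ↦ (adj j).unit.app M) (by
    apply Pi.hom_ext
    rintro ⟨i, j⟩
    simp only [descentFst, descentSnd, Category.assoc, Pi.lift_π, Pi.lift_π_assoc]
    exact (adj j).unit.naturality ((adj i).unit.app M))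

lemma descentHom_ι (j : Fin n) :
    descentHom adj M ≫ equalizer.ι _ _ ≫ Pi.π _ j = (adj j).unit.app M := by
  rw [descentHom, equalizer.lift_ι_assoc, Pi.lift_π]

lemma descent_condition (i j : Fin n) :
    equalizer.ι (descentFst adj M) (descentSnd adj M) ≫ Pi.π _ i ≫ (adj j).unit.app _ =
      equalizer.ι (descentFst adj M) (descentSnd adj M) ≫ Pi.π _ j ≫
        (R j).map ((L j).map ((adj i).unit.app M)) := by
  have := congrArg (· ≫ Pi.π _ (i, j)) (equalizer.condition (descentFst adj M) (descentSnd adj M))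
  simpa [descentFst, descentSnd] using this

/-- By joint conservativity it suffices to apply each `L k`. It preserves the equalizer and the
products, and the resulting fork is split by the counit of `L k ⊣ R k` on the `k`-th component. -/
lemma isIso_descentHom [∀ j, PreservesFiniteLimits (L j)]
    (hL : ∀ ⦃X Y : 𝒜⦄ (h : X ⟶ Y), (∀ j, IsIso ((L j).map h)) → IsIso h) :
    IsIso (descentHom adj M) := by
  refine hL _ fun k ↦ ?_
  let e := equalizer.ι (descentFst adj M) (descentSnd adj M)
  have hd (j : Fin n) : (L k).map (descentHom adj M) ≫ (L k).map e ≫ (L k).map (Pi.π _ j) =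
      (L k).map ((adj j).unit.app M) := by
    rw [← Functor.map_comp, ← Functor.map_comp, descentHom_ι]
  refine ⟨(L k).map e ≫ (L k).map (Pi.π _ k) ≫ (adj k).counit.app _, ?_, ?_⟩
  · rw [reassoc_of% hd k, Adjunction.left_triangle_components]
  · have : Mono ((L k).map e) := inferInstance
    rw [← cancel_mono ((L k).map e)]
    refine Limits.Fan.IsLimit.hom_ext (isLimitOfHasProductOfPreservesLimit (L k) _) _ _ fun i ↦ ?_
    refine (?_ : _ ≫ (L k).map (Pi.π _ i) = _ ≫ (L k).map (Pi.π _ i))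
    -- The gluing condition for `i` and `k` lets the counit be moved from the `k`-th component to
    -- the `i`-th, where a triangle identity finishes.
    have hc : (L k).map e ≫ (L k).map (Pi.π _ k) ≫
        (L k).map ((R k).map ((L k).map ((adj i).unit.app M))) =
          (L k).map e ≫ (L k).map (Pi.π _ i) ≫ (L k).map ((adj k).unit.app _) := by
      simp only [← Functor.map_comp]
      rw [descent_condition]
    simp only [Category.assoc, hd, Category.id_comp]
    rw [← Adjunction.counit_naturality, reassoc_of% hc, Adjunction.left_triangle_components]
    exact congrArg ((L k).map e ≫ ·) (Category.comp_id _)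

/-- The same equalizer, seen through a left exact functor `U` on generalized elements. With `U` the
forgetful functor, it glues morphisms of `C` that are not linear. -/
lemma existsUnique_descent [∀ j, PreservesFiniteLimits (L j)]
    (hL : ∀ ⦃X Y : 𝒜⦄ (h : X ⟶ Y), (∀ j, IsIso ((L j).map h)) → IsIso h)
    {C : Type*} [Category* C] (U : 𝒜 ⥤ C) [PreservesFiniteLimits U] {V : C}
    (y : ∀ j, V ⟶ U.obj ((R j).obj ((L j).obj M)))
    (hy : ∀ i j, y i ≫ U.map ((adj j).unit.app _) =
      y j ≫ U.map ((R j).map ((L j).map ((adj i).unit.app M)))) :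
    ∃! t : V ⟶ U.obj M, ∀ j, t ≫ U.map ((adj j).unit.app M) = y j := by
  have := isIso_descentHom adj M hL
  let E := equalizer (descentFst adj M) (descentSnd adj M)
  let e : E ⟶ _ := equalizer.ι (descentFst adj M) (descentSnd adj M)
  have hπ := isLimitOfHasProductOfPreservesLimit U (fun j ↦ (R j).obj ((L j).obj M))
  have hπ' := isLimitOfHasProductOfPreservesLimit U
    (fun p : Fin n × Fin n ↦ (R p.2).obj ((L p.2).obj ((R p.1).obj ((L p.1).obj M))))
  have he := isLimitOfHasEqualizerOfPreservesLimit U (descentFst adj M) (descentSnd adj M)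
  let z : V ⟶ U.obj (∏ᶜ fun j ↦ (R j).obj ((L j).obj M)) := Fan.IsLimit.lift hπ y
  have hz (j) : z ≫ U.map (Pi.π _ j) = y j := Fan.IsLimit.fac hπ y j
  obtain ⟨w, hw⟩ : ∃ w : V ⟶ U.obj E, w ≫ U.map e = z := by
    refine ⟨Fork.IsLimit.lift he z ?_, Fork.IsLimit.lift_ι _⟩
    refine Limits.Fan.IsLimit.hom_ext hπ' _ _ fun p ↦ ?_
    refine (?_ : _ ≫ U.map (Pi.π _ p) = _ ≫ U.map (Pi.π _ p))
    rw [Category.assoc, Category.assoc, ← U.map_comp, ← U.map_comp, descentFst, descentSnd,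
      Pi.lift_π, Pi.lift_π, U.map_comp, U.map_comp, reassoc_of% hz p.1, reassoc_of% hz p.2]
    exact hy p.1 p.2
  have hd (j : Fin n) : U.map (descentHom adj M) ≫ U.map e ≫ U.map (Pi.π _ j) =
      U.map ((adj j).unit.app M) := by
    rw [← Functor.map_comp, ← Functor.map_comp, descentHom_ι]
  refine ⟨w ≫ inv (U.map (descentHom adj M)), fun j ↦ ?_, fun t ht ↦ ?_⟩
  · simp only [← hd, Category.assoc, IsIso.inv_hom_id_assoc, reassoc_of% hw, hz]
  · rw [IsIso.eq_comp_inv]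
    refine Fork.IsLimit.hom_ext he ?_
    refine (?_ : _ ≫ U.map e = _ ≫ U.map e)
    refine Limits.Fan.IsLimit.hom_ext hπ _ _ fun j ↦ ?_
    refine (?_ : _ ≫ U.map (Pi.π _ j) = _ ≫ U.map (Pi.π _ j))
    rw [hw, hz, Category.assoc, Category.assoc, hd, ht]

end AbstractDescent

/-! ### Flat descent for the structure monoid -/

section Descent

variable {C : Type u} [Category.{v} C] [MonoidalCategory C] [SymmetricCategory C]
  [HasCoequalizers C] [MonoidalClosed C] {A B B' : CommMon C} (φ : A ⟶ B) (φ' : A ⟶ B')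

/-- The projection `B ⊗ A ⟶ B ⊗_A A`. -/
def regπ : B.X ⊗ A.X ⟶ extObj φ (regMod A) := extπ φ (regMod A)

/-- The morphism `a ↦ 1 ⊗ a` from `A` to `B ⊗_A A`. -/
def regι : A.X ⟶ extObj φ (regMod A) := extι φ (regMod A)

/-- The morphism of `C` underlying a morphism from the regular module. -/
def regHom {N : ModCat A} (h : regMod A ⟶ N) : A.X ⟶ N.X := h.hom

/-- The morphism `b ↦ b ⊗ 1` from `B` to `B ⊗_A A`. -/
def extReg : B.X ⟶ extObj φ (regMod A) := tensorInl B A ≫ regπ φ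

lemma whiskerRight_regπ : homX φ ▷ A.X ≫ regπ φ = MonObj.mul ≫ regι φ :=
  whiskerRight_extπ φ (regMod A)

lemma regπ_extAct : B.X ◁ regπ φ ≫ extAct φ (regMod A) =
    (α_ B.X B.X A.X).inv ≫ MonObj.mul ▷ A.X ≫ regπ φ :=
  extπ_extAct φ (regMod A)

lemma regπ_extMap {N : ModCat A} (h : regMod A ⟶ N) :
    regπ φ ≫ extMap φ h = B.X ◁ regHom h ≫ extπ φ N :=
  extπ_extMap φ h

lemma extReg_extMap {N : ModCat A} (h : regMod A ⟶ N) :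
    extReg φ ≫ extMap φ h =
      (ρ_ B.X).inv ≫ B.X ◁ (MonObj.one (X := A.X) ≫ regHom h) ≫ extπ φ N := by
  rw [extReg, Category.assoc, regπ_extMap, tensorInl, Category.assoc,
    ← MonoidalCategory.whiskerLeft_comp_assoc]

lemma regι_eq_extReg : regι φ = homX φ ≫ extReg φ := by
  rw [extReg, tensorInl, Category.assoc, rightUnitor_inv_naturality_assoc,
    ← whisker_exchange_assoc, whiskerRight_regπ, MonObj.mul_one_assoc, Iso.inv_hom_id_assoc]

lemma mul_extReg : MonObj.mul ≫ extReg φ = B.X ◁ extReg φ ≫ extAct φ (regMod A) := by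
  rw [extReg, MonoidalCategory.whiskerLeft_comp, Category.assoc, regπ_extAct, tensorInl,
    Category.assoc, rightUnitor_inv_naturality_assoc, ← whisker_exchange_assoc]
  simp

/-- The `A`-linear map `b ↦ b ⊗ 1` from `B` to `B ⊗_A A`. -/
def algToExt : algMod φ ⟶ (restrictScalars φ).obj ((extendScalars φ).obj (regMod A)) :=
  mkHom (extReg φ) (by
    change (homX φ ▷ B.X ≫ MonObj.mul) ≫ extReg φ =
      A.X ◁ extReg φ ≫ homX φ ▷ extObj φ (regMod A) ≫ extAct φ (regMod A)
    rw [Category.assoc, mul_extReg, whisker_exchange_assoc])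

lemma one_regι : MonObj.one (X := A.X) ≫ regι φ = MonObj.one (X := B.X) ≫ extReg φ := by
  rw [regι_eq_extReg, ← Category.assoc, IsMonHom.one_hom]

/-- The module `B ⊗_A A`, as an `A`-module. -/
abbrev resExt : ModCat A := (restrictScalars φ).obj ((extendScalars φ).obj (regMod A))

/-- The unit `A ⟶ B ⊗_A A`. -/
def regUnit : regMod A ⟶ resExt φ := (extendRestrictAdj φ).unit.app (regMod A)

lemma regHom_regUnit : regHom (regUnit φ) = regι φ := extendRestrictAdj_unit_hom φ (regMod A)

/-- The morphism `B ⊗_A B' ⟶ B ⊗_A (B' ⊗_A A)`. -/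
def descentMap : (pushoutMon φ φ').X ⟶ extObj φ (resExt φ') := extMap φ (algToExt φ')

lemma pushoutπ_descentMap :
    pushoutπ φ φ' ≫ descentMap φ φ' = B.X ◁ extReg φ' ≫ extπ φ (resExt φ') :=
  extπ_extMap φ (algToExt φ')

/-- Together with `extReg_extι`, this expresses the two descent maps through the two maps into `B
⊗_A B'`, followed by one common map `descentMap`. Agreement in the pushout thus implies the abstract
gluing condition. -/
lemma extReg_descent :
    extReg φ ≫ extMap φ (regUnit φ') = homX (pushoutInl φ φ') ≫ descentMap φ φ' := by
  have h : MonObj.one (X := A.X) ≫ regHom (regUnit φ') = MonObj.one (X := B'.X) ≫ extReg φ' :=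
    (congrArg (MonObj.one (X := A.X) ≫ ·) (regHom_regUnit φ')).trans (one_regι φ')
  rw [extReg_extMap, homX_pushoutInl, Category.assoc, pushoutπ_descentMap, tensorInl,
    Category.assoc]
  refine (congrArg (fun z ↦ (ρ_ B.X).inv ≫ B.X ◁ z ≫ extπ φ (resExt φ')) h).trans ?_
  refine congrArg ((ρ_ B.X).inv ≫ ·) ?_
  exact (congrArg (· ≫ extπ φ (resExt φ')) (MonoidalCategory.whiskerLeft_comp _ _ _)).trans
    (Category.assoc _ _ _)

lemma extReg_extι :
    extReg φ' ≫ extι φ (resExt φ') = homX (pushoutInr φ φ') ≫ descentMap φ φ' := by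
  refine (extι_extMap φ (algToExt φ')).symm.trans ?_
  exact congrArg (· ≫ descentMap φ φ') (Category.assoc _ _ _).symm

/-- The morphism `B ⊗_A A ⟶ B` of multiplication. -/
def extMul : extObj φ (regMod A) ⟶ B.X :=
  extDesc φ (N := regMod B) (mkHom (homX φ) (IsMonHom.mul_hom (homX φ) |>.trans (by
    rw [MonoidalCategory.tensorHom_def', Category.assoc]
    rfl)))

lemma regπ_extMul : regπ φ ≫ extMul φ = B.X ◁ homX φ ≫ MonObj.mul := extπ_extDesc φ _

lemma extReg_extMul : extReg φ ≫ extMul φ = 𝟙 B.X := by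
  rw [extReg, Category.assoc, regπ_extMul, tensorInl, Category.assoc,
    ← MonoidalCategory.whiskerLeft_comp_assoc, IsMonHom.one_hom, MonObj.mul_one, Iso.inv_hom_id]

/-- Descent for the regular module makes `A` the equalizer of the `B_j` over their pairwise
pushouts. The abstract statement involves `B_j ⊗_A A` rather than `B_j`. -/
lemma existsUnique_of_cover [HasFiniteLimits C] {n : ℕ} {B : Fin n → CommMon C}
    (φ : ∀ j, A ⟶ B j) (hφ : ∀ j, IsFlat (φ j))
    (hc : ∀ ⦃M N : ModCat A⦄ (h : M ⟶ N), (∀ j, IsIso ((extendScalars (φ j)).map h)) → IsIso h)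
    {V : C} (y : ∀ j, V ⟶ (B j).X)
    (hy : ∀ i j, y i ≫ homX (pushoutInl (φ i) (φ j)) = y j ≫ homX (pushoutInr (φ i) (φ j))) :
    ∃! t : V ⟶ A.X, ∀ j, t ≫ homX (φ j) = y j := by
  have (j : Fin n) : PreservesFiniteLimits (extendScalars (φ j)) := hφ j
  have : PreservesFiniteLimits (forgetMod A) := ⟨fun _ _ _ ↦ inferInstance⟩
  have key := existsUnique_descent (fun j ↦ extendRestrictAdj (φ j)) (regMod A) hc (forgetMod A)
    (fun j ↦ y j ≫ extReg (φ j)) (fun i j ↦ by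
      refine (Category.assoc _ _ _).trans (Eq.trans ?_ (Category.assoc _ _ _).symm)
      have h1 : extReg (φ i) ≫ ((extendRestrictAdj (φ j)).unit.app (resExt (φ i))).hom = _ :=
        (congrArg (extReg (φ i) ≫ ·) (extendRestrictAdj_unit_hom (φ j) _)).trans
          (extReg_extι (φ j) (φ i))
      have h2 := extReg_descent (φ j) (φ i)
      refine (congrArg (y i ≫ ·) h1).trans (Eq.trans ?_ (congrArg (y j ≫ ·) h2).symm)
      refine (Category.assoc _ _ _).symm.trans (Eq.trans ?_ (Category.assoc _ _ _))
      exact congrArg (· ≫ descentMap (φ j) (φ i)) (hy j i).symm)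
  have hiff (t : V ⟶ A.X) (j : Fin n) :
      t ≫ regHom (regUnit (φ j)) = y j ≫ extReg (φ j) ↔ t ≫ homX (φ j) = y j := by
    -- The retraction `extMul` is all that is needed to cancel `extReg` and return from `B_j ⊗_A A`
    -- to `B_j`.
    have : IsSplitMono (extReg (φ j)) := ⟨⟨⟨extMul (φ j), extReg_extMul (φ j)⟩⟩⟩
    have e : t ≫ regι (φ j) = y j ≫ extReg (φ j) ↔ t ≫ homX (φ j) = y j := by
      rw [regι_eq_extReg, ← Category.assoc, cancel_mono]
    exact (iff_of_eq (congrArg (fun z ↦ t ≫ z = y j ≫ extReg (φ j)) (regHom_regUnit (φ j)))).trans e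
  obtain ⟨t, ht, ht'⟩ := key
  exact ⟨t, fun j ↦ (hiff t j).1 (ht j), fun s hs ↦ ht' s fun j ↦ (hiff s j).2 (hs j)⟩

end Descent

/-! ### The Zariski topology is subcanonical -/

section Subcanonical

variable {C : Type u} [Category.{v} C] [MonoidalCategory C] [SymmetricCategory C]
  [HasCoequalizers C] [MonoidalClosed C] [HasFiniteLimits C]

/-- Descent first glues the underlying morphisms of `C`. Uniqueness of gluing, for maps out of the
unit and out of the tensor square of the monoid of `W`, then shows that the result is a morphism of
monoids. -/
lemma existsUnique_hom_of_cover {n : ℕ} {X W : Aff C} {Y : Fin n → Aff C} {p : ∀ j, Y j ⟶ X}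
    (ho : ∀ j, IsFlat (p j).unop) (hc : Conservative p) (y : ∀ j, Y j ⟶ W)
    (hy : ∀ i j (Z : Aff C) (a : Z ⟶ Y i) (b : Z ⟶ Y j), a ≫ p i = b ≫ p j →
      a ≫ y i = b ≫ y j) : ∃! t : X ⟶ W, ∀ j, p j ≫ t = y j := by
  have hV {V : C} (z : ∀ j, V ⟶ (Y j).unop.X) := existsUnique_of_cover (fun j ↦ (p j).unop) ho hc z
  have hext {V : C} (a b : V ⟶ X.unop.X)
      (h : ∀ j, a ≫ homX (p j).unop = b ≫ homX (p j).unop) : a = b := by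
    refine (hV (fun j ↦ b ≫ homX (p j).unop) fun i j ↦ ?_).unique h fun j ↦ rfl
    rw [Category.assoc, Category.assoc, ← homX_comp, ← homX_comp, pushoutMon_condition]
  obtain ⟨t, ht, -⟩ := hV (fun j ↦ homX (y j).unop) fun i j ↦ by
    rw [← homX_comp, ← homX_comp]
    exact congrArg (fun q ↦ homX (Quiver.Hom.unop q))
      (hy i j _ (pushoutInl (p i).unop (p j).unop).op (pushoutInr (p i).unop (p j).unop).op
        (congrArg Quiver.Hom.op (pushoutMon_condition (p i).unop (p j).unop)))
  have hm : IsMonHom t :=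
    { one_hom := hext _ _ fun j ↦ by
        rw [Category.assoc, ht, IsMonHom.one_hom, IsMonHom.one_hom]
      mul_hom := hext _ _ fun j ↦ by
        rw [Category.assoc, ht, IsMonHom.mul_hom, Category.assoc, IsMonHom.mul_hom,
          tensorHom_comp_tensorHom_assoc, ht] }
  refine ⟨(mkMonHom (A := W.unop) (B := X.unop) t hm).op, fun j ↦ ?_, fun s hs ↦ ?_⟩
  · apply Quiver.Hom.unop_inj
    exact homX_injective (ht j)
  · apply Quiver.Hom.unop_inj
    refine homX_injective (hext _ _ fun j ↦ ?_)
    rw [← homX_comp]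
    exact (congrArg (fun q ↦ homX (Quiver.Hom.unop q)) (hs j)).trans (ht j).symm

lemma isSheafFor_yoneda_ofArrows (W : Aff C) {n : ℕ} {X : Aff C} {Y : Fin n → Aff C}
    {p : ∀ j, Y j ⟶ X} (ho : ∀ j, IsFlat (p j).unop) (hc : Conservative p) :
    Presieve.IsSheafFor (yoneda.obj W) (Presieve.ofArrows Y p) := by
  rw [Presieve.isSheafFor_arrows_iff]
  intro y hy
  exact existsUnique_hom_of_cover ho hc y fun i j Z a b h ↦ hy i j Z a b h

instance : (zariskiTopology C).Subcanonical := by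
  refine GrothendieckTopology.Subcanonical.of_isSheaf_yoneda_obj _ fun W ↦ ?_
  rw [zariskiTopology, Precoverage.isSheaf_toGrothendieck_iff_of_isStableUnderBaseChange]
  intro X R hR
  obtain ⟨ι, Z, q, rfl⟩ := R.exists_eq_ofArrows
  obtain ⟨ho, n, e, he⟩ := (mem_zariskiPrecoverage_ofArrows_iff q).1 hR
  rw [Presieve.isSheafFor_iff_generate]
  -- An arbitrary covering is replaced by its finite conservative subfamily. Passing to a larger
  -- sieve requires the sheaf condition for every pullback of the smaller one, and these pullbacks
  -- are again finite flat coverings.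
  refine Presieve.isSheafFor_subsieve _
    (S := .generate (Presieve.ofArrows (fun j ↦ Z (e j)) fun j ↦ q (e j)))
    (Sieve.generate_mono ?_) ?_
  · rintro _ _ ⟨j⟩
    exact ⟨e j⟩
  · intro Y' h
    rw [← Sieve.pullbackArrows_comm, ← Presieve.isSheafFor_iff_generate,
      ← Presieve.ofArrows_pullback]
    exact isSheafFor_yoneda_ofArrows W
      (fun j ↦ ((ho (e j)).of_isPullback
        (IsPullback.of_hasPullback (q (e j)) h).flip).flat)
      (he.of_isPullback fun j ↦ (IsPullback.of_hasPullback (q (e j)) h).flip)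

end Subcanonical

/-! ### Sifted colimits of commutative monoids -/

section CommMonColimits

variable {C : Type u} [Category.{v} C] [MonoidalCategory C] [SymmetricCategory C]
  [MonoidalClosed C] {J : Type*} [Category* J]

instance (Z : C) : PreservesColimitsOfShape J (tensorLeft Z) :=
  (ihom.adjunction Z).leftAdjoint_preservesColimits.preservesColimitsOfShape

instance (Z : C) : PreservesColimitsOfShape J (tensorRight Z) :=
  preservesColimitsOfShape_of_natIso (BraidedCategory.tensorLeftIsoTensorRight Z)

instance (Z : C) : PreservesColimitsOfShape J ((curriedTensor C).obj Z) :=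
  inferInstanceAs (PreservesColimitsOfShape J (tensorLeft Z))

instance (Z : C) : PreservesColimitsOfShape J ((curriedTensor C).flip.obj Z) :=
  inferInstanceAs (PreservesColimitsOfShape J (tensorRight Z))

lemma isIso_of_homX {A B : CommMon C} (φ : A ⟶ B) [IsIso (homX φ)] : IsIso φ := by
  have h : IsMonHom (inv (homX φ)) :=
    { one_hom := by rw [IsIso.comp_inv_eq, IsMonHom.one_hom]
      mul_hom := by
        rw [IsIso.comp_inv_eq, Category.assoc, IsMonHom.mul_hom, tensorHom_comp_tensorHom_assoc]
        simp }
  refine ⟨mkMonHom _ h, homX_injective ?_, homX_injective ?_⟩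
  · exact IsIso.hom_inv_id (homX φ)
  · exact IsIso.inv_hom_id (homX φ)

instance : (CommMon.forget C).ReflectsIsomorphisms where
  reflects φ _ :=
    have : IsIso (homX φ) := ‹IsIso ((CommMon.forget C).map φ)›
    isIso_of_homX φ

variable [IsSifted J]

/-- The tensor product of two colimit cocones over a sifted diagram is a colimit cocone. -/
def isColimitTensor {F₁ F₂ : J ⥤ C} {c₁ : Cocone F₁} {c₂ : Cocone F₂} (h₁ : IsColimit c₁)
    (h₂ : IsColimit c₂) : IsColimit (c₁.tensor c₂) := IsColimit.tensor h₁ h₂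

lemma hom_ext_tensor {F₁ F₂ : J ⥤ C} {c₁ : Cocone F₁} {c₂ : Cocone F₂} (h₁ : IsColimit c₁)
    (h₂ : IsColimit c₂) {W : C} {a b : c₁.pt ⊗ c₂.pt ⟶ W}
    (h : ∀ j, (c₁.ι.app j ⊗ₘ c₂.ι.app j) ≫ a = (c₁.ι.app j ⊗ₘ c₂.ι.app j) ≫ b) : a = b :=
  (isColimitTensor h₁ h₂).hom_ext h

lemma exists_desc_tensor {F₁ F₂ : J ⥤ C} {c₁ : Cocone F₁} {c₂ : Cocone F₂} (h₁ : IsColimit c₁)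
    (h₂ : IsColimit c₂) {W : C} (k : ∀ j, F₁.obj j ⊗ F₂.obj j ⟶ W)
    (hk : ∀ {i j : J} (f : i ⟶ j), (F₁.map f ⊗ₘ F₂.map f) ≫ k j = k i) :
    ∃ a : c₁.pt ⊗ c₂.pt ⟶ W, ∀ j, (c₁.ι.app j ⊗ₘ c₂.ι.app j) ≫ a = k j := by
  let s : Cocone (F₁ ⊗ F₂) :=
    { pt := W
      ι :=
        { app := k
          naturality := fun _ _ f ↦ (hk f).trans (Category.comp_id _).symm } }
  exact ⟨(isColimitTensor h₁ h₂).desc s, (isColimitTensor h₁ h₂).fac s⟩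

/-- The legs of a cocone over the underlying objects of a diagram of commutative monoids. -/
def coleg {F : J ⥤ CommMon C} (c : Cocone (F ⋙ CommMon.forget C)) (j : J) :
    (F.obj j).X ⟶ c.pt := c.ι.app j

lemma map_coleg {F : J ⥤ CommMon C} (c : Cocone (F ⋙ CommMon.forget C)) {i j : J} (f : i ⟶ j) :
    homX (F.map f) ≫ coleg c j = coleg c i := c.w f

variable {F : J ⥤ CommMon C} {c : Cocone (F ⋙ CommMon.forget C)}

/-- The tensor product preserves colimits in each variable, and the diagonal of a sifted category is
final. So `c.pt ⊗ c.pt` is the colimit of the tensor squares, and the multiplications induce a map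
on it. -/
lemma exists_colimitMul (hc : IsColimit c) : ∃ m : c.pt ⊗ c.pt ⟶ c.pt, ∀ j,
    (coleg c j ⊗ₘ coleg c j) ≫ m = MonObj.mul ≫ coleg c j :=
  exists_desc_tensor hc hc (fun j ↦ MonObj.mul (X := (F.obj j).X) ≫ coleg c j) fun {i j} f ↦ by
    have h := IsMonHom.mul_hom (homX (F.map f))
    refine (?_ : (homX (F.map f) ⊗ₘ homX (F.map f)) ≫ MonObj.mul ≫ coleg c j = _)
    rw [← reassoc_of% h, map_coleg]
    rfl

/-- The multiplication of a sifted colimit of commutative monoids. -/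
def colimitMul (hc : IsColimit c) : c.pt ⊗ c.pt ⟶ c.pt := (exists_colimitMul hc).choose

lemma coleg_colimitMul (hc : IsColimit c) (j : J) :
    (coleg c j ⊗ₘ coleg c j) ≫ colimitMul hc = MonObj.mul ≫ coleg c j :=
  (exists_colimitMul hc).choose_spec j

/-- The unit of a sifted colimit of commutative monoids. -/
def colimitOne (c : Cocone (F ⋙ CommMon.forget C)) : 𝟙_ C ⟶ c.pt :=
  MonObj.one ≫ coleg c (IsSifted.nonempty (C := J)).some

/-- A sifted category is connected, so the unit does not depend on the stage chosen in `colimitOne`.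
-/
lemma one_coleg (c : Cocone (F ⋙ CommMon.forget C)) (j : J) :
    MonObj.one ≫ coleg c j = colimitOne c := by
  have : ∀ (i j : J) (_ : i ⟶ j), (MonObj.one (X := (F.obj i).X)) ≫ coleg c i =
      (MonObj.one (X := (F.obj j).X)) ≫ coleg c j := fun i j f ↦ by
    rw [← map_coleg c f, ← Category.assoc, IsMonHom.one_hom]
  exact constant_of_preserves_morphisms (fun j ↦ (MonObj.one (X := (F.obj j).X)) ≫ coleg c j)
    this _ _

lemma coleg_hom_ext (hc : IsColimit c) {W : C} {a b : c.pt ⟶ W}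
    (h : ∀ j, coleg c j ≫ a = coleg c j ≫ b) : a = b :=
  hc.hom_ext h

lemma coleg_hom_ext₂ (hc : IsColimit c) {W : C} {a b : c.pt ⊗ c.pt ⟶ W}
    (h : ∀ j, (coleg c j ⊗ₘ coleg c j) ≫ a = (coleg c j ⊗ₘ coleg c j) ≫ b) : a = b :=
  hom_ext_tensor hc hc h

/-- Siftedness allows the same index in all three factors, so associativity is checked at a single
stage. -/
lemma coleg_hom_ext₃ (hc : IsColimit c) {W : C} {a b : (c.pt ⊗ c.pt) ⊗ c.pt ⟶ W}
    (h : ∀ j, ((coleg c j ⊗ₘ coleg c j) ⊗ₘ coleg c j) ≫ a =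
      ((coleg c j ⊗ₘ coleg c j) ⊗ₘ coleg c j) ≫ b) : a = b :=
  hom_ext_tensor (isColimitTensor hc hc) hc h

/-- The monoid structure on a sifted colimit of commutative monoids. -/
@[reducible] def colimitMonObj (hc : IsColimit c) : MonObj c.pt where
  one := colimitOne c
  mul := colimitMul hc
  one_mul := by
    rw [← cancel_epi (λ_ c.pt).inv]
    refine coleg_hom_ext hc fun j ↦ ?_
    rw [leftUnitor_inv_naturality_assoc, whisker_exchange_assoc, ← one_coleg c j,
      comp_whiskerRight_assoc, ← MonoidalCategory.tensorHom_def_assoc, coleg_colimitMul]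
    simp
  mul_one := by
    rw [← cancel_epi (ρ_ c.pt).inv]
    refine coleg_hom_ext hc fun j ↦ ?_
    rw [rightUnitor_inv_naturality_assoc, ← whisker_exchange_assoc, ← one_coleg c j,
      MonoidalCategory.whiskerLeft_comp_assoc, ← MonoidalCategory.tensorHom_def'_assoc,
      coleg_colimitMul]
    simp
  mul_assoc := by
    refine coleg_hom_ext₃ hc fun j ↦ ?_
    have hl {X : C} (a : X ⟶ (F.obj j).X) : (a ≫ coleg c j ⊗ₘ coleg c j) ≫ colimitMul hc =
        a ▷ (F.obj j).X ≫ MonObj.mul ≫ coleg c j := by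
      rw [← coleg_colimitMul hc, ← tensorHom_id, tensorHom_comp_tensorHom_assoc, Category.id_comp]
    have hr {X : C} (a : X ⟶ (F.obj j).X) : (coleg c j ⊗ₘ a ≫ coleg c j) ≫ colimitMul hc =
        (F.obj j).X ◁ a ≫ MonObj.mul ≫ coleg c j := by
      rw [← coleg_colimitMul hc, ← id_tensorHom, tensorHom_comp_tensorHom_assoc, Category.id_comp]
    rw [← tensorHom_id, tensorHom_comp_tensorHom_assoc, coleg_colimitMul, Category.comp_id, hl,
      associator_naturality_assoc, ← id_tensorHom, tensorHom_comp_tensorHom_assoc,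
      coleg_colimitMul, Category.comp_id, hr, MonObj.mul_assoc_assoc]

lemma isCommMonObj_colimit (hc : IsColimit c) :
    letI := colimitMonObj hc
    IsCommMonObj c.pt :=
  letI := colimitMonObj hc
  { mul_comm := coleg_hom_ext₂ hc fun j ↦ by
      change _ ≫ _ ≫ colimitMul hc = _ ≫ colimitMul hc
      rw [BraidedCategory.braiding_naturality_assoc, coleg_colimitMul,
        IsCommMonObj.mul_comm_assoc] }

/-- A sifted colimit of commutative monoids. -/
def colimitMon (hc : IsColimit c) : CommMon C :=
  letI := colimitMonObj hc
  haveI := isCommMonObj_colimit hc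
  { X := c.pt }

/-- The colimit cocone of a sifted diagram of commutative monoids. -/
def colimitMonCocone (hc : IsColimit c) : Cocone F where
  pt := colimitMon hc
  ι :=
    { app := fun j ↦ mkMonHom (B := colimitMon hc) (coleg c j)
        { one_hom := one_coleg c j
          mul_hom := (coleg_colimitMul hc j).symm }
      naturality := fun _ _ f ↦ homX_injective
        ((map_coleg c f).trans (Category.comp_id _).symm) }

/-- The morphism of `C` underlying the one from the colimit. -/
def colimitDesc (hc : IsColimit c) (s : Cocone F) : c.pt ⟶ s.pt.X :=
  hc.desc ((CommMon.forget C).mapCocone s)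

lemma coleg_colimitDesc (hc : IsColimit c) (s : Cocone F) (j : J) :
    coleg c j ≫ colimitDesc hc s = homX (s.ι.app j) :=
  hc.fac ((CommMon.forget C).mapCocone s) j

lemma isMonHom_colimitDesc (hc : IsColimit c) (s : Cocone F) :
    letI := colimitMonObj hc
    IsMonHom (colimitDesc hc s) :=
  letI := colimitMonObj hc
  { one_hom := by
      obtain ⟨j⟩ := IsSifted.nonempty (C := J)
      change colimitOne c ≫ _ = _
      rw [← one_coleg c j, Category.assoc, coleg_colimitDesc, IsMonHom.one_hom]
    mul_hom := coleg_hom_ext₂ hc fun j ↦ by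
      change _ ≫ colimitMul hc ≫ _ = _
      rw [reassoc_of% coleg_colimitMul hc j, coleg_colimitDesc, tensorHom_comp_tensorHom_assoc,
        coleg_colimitDesc, IsMonHom.mul_hom] }

/-- The colimit cocone of a sifted diagram of commutative monoids is a colimit cocone. -/
def isColimitColimitMonCocone (hc : IsColimit c) : IsColimit (colimitMonCocone hc) where
  desc s := mkMonHom (A := colimitMon hc) (colimitDesc hc s) (isMonHom_colimitDesc hc s)
  fac s j := homX_injective (coleg_colimitDesc hc s j)
  uniq s _ w := homX_injective (coleg_hom_ext hc fun j ↦
    (congrArg homX (w j)).trans (coleg_colimitDesc hc s j).symm)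

instance (F : J ⥤ CommMon C) : CreatesColimit F (CommMon.forget C) :=
  createsColimitOfReflectsIso fun _ hc ↦
    { liftedCocone := colimitMonCocone hc
      validLift := Cocone.ext (Iso.refl _) fun _ ↦ Category.comp_id _
      makesColimit := isColimitColimitMonCocone hc }

instance : CreatesColimitsOfShape J (CommMon.forget C) := ⟨inferInstance⟩

instance [HasColimitsOfShape J C] : HasColimitsOfShape J (CommMon C) :=
  hasColimitsOfShape_of_hasColimitsOfShape_createsColimitsOfShape (CommMon.forget C)

instance [HasColimitsOfShape J C] : PreservesColimitsOfShape J (CommMon.forget C) :=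
  preservesColimitOfShape_of_createsColimitsOfShape_and_hasColimitsOfShape _

end CommMonColimits

/-! ### Transport of flatness and conservativity along the adjunction -/

section BaseChange

variable {C D : Type u} [Category.{v} C] [MonoidalCategory C] [SymmetricCategory C]
  [Category.{v} D] [MonoidalCategory D] [SymmetricCategory D]
  {f : C ⥤ D} [f.Braided] {g : D ⥤ C} (adj : f ⊣ g)

/-- The functor `commRight` is `g` on underlying objects. -/
def commRightForget : commRight adj ⋙ CommMon.forget C ≅ CommMon.forget D ⋙ g := Iso.refl _

/-- Filtered categories are sifted, so these colimits are computed on underlying objects, where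
`commRight` is `g`. -/
lemma preservesFilteredColimits_commRight [MonoidalClosed C] [MonoidalClosed D]
    [HasColimitsOfSize.{v, v} C] [HasColimitsOfSize.{v, v} D]
    [PreservesFilteredColimitsOfSize.{v, v} g] :
    PreservesFilteredColimitsOfSize.{v, v} (commRight adj) := by
  refine ⟨fun J _ _ ↦ ?_⟩
  have : IsSifted J := IsFiltered.isSifted
  have : PreservesColimitsOfShape J (commRight adj ⋙ CommMon.forget C) :=
    preservesColimitsOfShape_of_natIso (commRightForget adj).symm
  have : ReflectsColimitsOfShape J (CommMon.forget C) :=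
    reflectsColimitsOfShape_of_reflectsIsomorphisms
  exact preservesColimitsOfShape_of_reflects_of_preserves _ (CommMon.forget C)

/-- The functor `gMod` is `g` on underlying objects. -/
def gModForget (A : CommMon C) : gMod adj A ⋙ forgetMod A ≅ forgetMod _ ⋙ g :=
  NatIso.ofComponents (fun N ↦ Iso.refl (g.obj N.X)) fun h ↦
    (Category.comp_id (g.map h.hom)).trans (Category.id_comp (g.map h.hom)).symm

lemma preservesLimitsOfShape_gMod {J : Type*} [Category* J] [HasLimitsOfShape J C]
    [HasLimitsOfShape J D] (A : CommMon C) : PreservesLimitsOfShape J (gMod adj A) := by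
  have : PreservesLimitsOfShape J g := adj.rightAdjoint_preservesLimits.preservesLimitsOfShape
  have : PreservesLimitsOfShape J (gMod adj A ⋙ forgetMod A) :=
    preservesLimitsOfShape_of_natIso (gModForget adj A).symm
  exact preservesLimitsOfShape_of_comp_forgetMod _

lemma reflectsIsomorphisms_gMod [g.ReflectsIsomorphisms] (A : CommMon C) :
    (gMod adj A).ReflectsIsomorphisms where
  reflects h _ := by
    have : IsIso (g.map h.hom) := inferInstanceAs (IsIso ((gMod adj A).map h).hom)
    have : IsIso h.hom := isIso_of_reflects_iso h.hom g
    exact isIso_of_hom h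

variable [HasCoequalizers C] [MonoidalClosed C] [HasCoequalizers D] [MonoidalClosed D]
  {A B : CommMon C} (φ : A ⟶ B)

lemma baseChangeMap_aux {N N' : ModCat (f.mapCommMon.obj A)} (h : N ⟶ N') :
    (gMod adj A).map h ≫
        (gMod adj A).map ((extendRestrictAdj (f.mapCommMon.map φ)).unit.app N') ≫
          gModRestrict adj φ _ =
      ((gMod adj A).map ((extendRestrictAdj (f.mapCommMon.map φ)).unit.app N) ≫
        gModRestrict adj φ _) ≫ (restrictScalars φ).map ((gMod adj B).map
          ((extendScalars (f.mapCommMon.map φ)).map h)) := by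
  have e := congrArg (fun k ↦ g.map (Mod.Hom.hom k))
    ((extendRestrictAdj (f.mapCommMon.map φ)).unit.naturality h)
  ext
  refine (?_ : g.map h.hom ≫
    g.map ((extendRestrictAdj (f.mapCommMon.map φ)).unit.app N').hom ≫ 𝟙 _ =
      (g.map ((extendRestrictAdj (f.mapCommMon.map φ)).unit.app N).hom ≫ 𝟙 _) ≫
        g.map ((extendScalars (f.mapCommMon.map φ)).map h).hom)
  rw [Category.comp_id, Category.comp_id]
  exact (g.map_comp _ _).symm.trans (e.trans (g.map_comp _ _))

lemma baseChangeMap_naturality {N N' : ModCat (f.mapCommMon.obj A)} (h : N ⟶ N') :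
    (extendScalars φ).map ((gMod adj A).map h) ≫ baseChangeMap adj φ N' =
      baseChangeMap adj φ N ≫ (gMod adj B).map ((extendScalars (f.mapCommMon.map φ)).map h) := by
  rw [baseChangeMap, baseChangeMap, ← Adjunction.homEquiv_naturality_left_symm,
    ← Adjunction.homEquiv_naturality_right_symm, baseChangeMap_aux]

/-- The base change isomorphism, as an isomorphism of functors. -/
def gModExtendIso (h : ∀ N, IsIso (baseChangeMap adj φ N)) :
    gMod adj A ⋙ extendScalars φ ≅ extendScalars (f.mapCommMon.map φ) ⋙ gMod adj B :=
  haveI := h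
  NatIso.ofComponents (fun N ↦ asIso (baseChangeMap adj φ N)) fun k ↦
    baseChangeMap_naturality adj φ k

variable {φ} in
-- `f(B) ⊗_{f(A)} -` followed by `g` is `g` followed by `B ⊗_A -`, hence preserves finite limits. As
-- `g` on `f(B)`-modules reflects them, the first functor preserves them.
lemma IsFlat.mapCommMon [HasFiniteLimits C] [HasFiniteLimits D] [g.ReflectsIsomorphisms]
    (hφ : IsFlat φ) (h : ∀ N, IsIso (baseChangeMap adj φ N)) : IsFlat (f.mapCommMon.map φ) := by
  refine ⟨fun J _ _ ↦ ?_⟩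
  have : PreservesFiniteLimits (extendScalars φ) := hφ
  have := preservesLimitsOfShape_gMod (J := J) adj A
  have := preservesLimitsOfShape_gMod (J := J) adj B
  have := reflectsIsomorphisms_gMod adj B
  have : ReflectsLimitsOfShape J (gMod adj B) := reflectsLimitsOfShape_of_reflectsIsomorphisms
  have : PreservesLimitsOfShape J (extendScalars (f.mapCommMon.map φ) ⋙ gMod adj B) :=
    preservesLimitsOfShape_of_natIso (gModExtendIso adj φ h)
  exact preservesLimitsOfShape_of_reflects_of_preserves _ (gMod adj B)

/-- If `k` becomes invertible over each `f(X i)`, base change makes `g(k)` invertible over each `X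
i`. So `g(k)` is invertible, and so is `k`. -/
lemma Conservative.affLeft [g.ReflectsIsomorphisms] {ι : Type*} {S : Aff C} {X : ι → Aff C}
    {p : ∀ i, X i ⟶ S} (hp : Conservative p)
    (h : ∀ i N, IsIso (baseChangeMap adj (p i).unop N)) :
    Conservative (fun i ↦ (affLeft f).map (p i)) := by
  intro M N k hk
  have := reflectsIsomorphisms_gMod adj S.unop
  have : IsIso ((gMod adj S.unop).map k) := hp _ fun i ↦ by
    have : IsIso ((extendScalars (f.mapCommMon.map (p i).unop)).map k) := hk i
    exact (NatIso.isIso_map_iff (gModExtendIso adj (p i).unop (h i)) k).2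
      (inferInstanceAs (IsIso ((gMod adj (X i).unop).map
        ((extendScalars (f.mapCommMon.map (p i).unop)).map k))))
  exact isIso_of_reflects_iso k (gMod adj S.unop)

end BaseChange

/-! ### Continuity of `f` for the Zariski topologies -/

section Continuity

variable {C D : Type u}
  [Category.{v} C] [MonoidalCategory C] [SymmetricCategory C] [MonoidalClosed C]
  [HasFiniteLimits C] [HasColimits C]
  [Category.{v} D] [MonoidalCategory D] [SymmetricCategory D] [MonoidalClosed D]
  [HasFiniteLimits D] [HasColimits D]
  {f : C ⥤ D} [f.Braided] {g : D ⥤ C} (adj : f ⊣ g) [g.ReflectsIsomorphisms]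
  [PreservesFilteredColimitsOfSize.{v, v} g]

/-- Flat base change: `g(N) ⊗_A B ≅ g(N ⊗_{f(A)} f(B))` for `A ⟶ B` flat. -/
def FlatBaseChange : Prop :=
  ∀ (A B : CommMon C) (φ : A ⟶ B), IsFlat φ →
    ∀ N : ModCat (f.mapCommMon.obj A), IsIso (baseChangeMap adj φ N)

variable {adj}

lemma IsZariskiOpen.affLeft (hbc : FlatBaseChange adj) {X Y : Aff C} {p : Y ⟶ X}
    (hp : IsZariskiOpen p) : IsZariskiOpen ((affLeft f).map p) := by
  have := preservesFilteredColimits_commRight adj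
  have := hp.epi
  have := (commAdj adj).leftAdjoint_preservesColimits
  have h : Epi (f.mapCommMon.map p.unop) := inferInstance
  exact ⟨hp.flat.mapCommMon adj (hbc _ _ _ hp.flat), h,
    (hp.finitePresentation.liftsToStage.map_leftAdjoint (commAdj adj)).isOfFinitePresentation⟩

/-- On commutative monoids `f` is a left adjoint and preserves pushouts, so on affine schemes it
preserves pullbacks. A functor that preserves pullbacks and coverings is continuous. -/
lemma isContinuous_affLeft (hbc : FlatBaseChange adj) :
    (RelSch.affLeft f).IsContinuous (zariskiTopology C) (zariskiTopology D) := by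
  have : PreservesColimitsOfShape WalkingCospanᵒᵖ f.mapCommMon :=
    (commAdj adj).leftAdjoint_preservesColimits.preservesColimitsOfShape
  have : PreservesLimitsOfShape WalkingCospan (RelSch.affLeft f) :=
    preservesLimitsOfShape_op WalkingCospan f.mapCommMon
  refine Functor.isContinuous_toGrothendieck_of_pullbacksPreservedBy _ _ _ fun X R hR ↦ ?_
  obtain ⟨ι, Y, p, rfl⟩ := R.exists_eq_ofArrows
  rw [Precoverage.mem_comap_iff, Presieve.map_ofArrows, mem_zariskiPrecoverage_ofArrows_iff]
  obtain ⟨ho, n, e, he⟩ := (mem_zariskiPrecoverage_ofArrows_iff p).1 hR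
  exact ⟨fun i ↦ (ho i).affLeft hbc, n, e, he.affLeft adj fun j ↦ hbc _ _ _ (ho (e j)).flat⟩

end Continuity

/-! ### Jointly epimorphic families of sheaves are the locally surjective ones -/

section JointlyEpi

variable {C : Type u} [Category.{v} C] [MonoidalCategory C] [SymmetricCategory C]
  [HasCoequalizers C] [MonoidalClosed C] [(zariskiTopology C).Subcanonical]

lemma hom_ext_of_cover {Y : Aff C} {S : Sieve Y} (hS : S ∈ zariskiTopology C Y) {F : Sh C}
    {a b : (affSheaf C).obj Y ⟶ F}
    (h : ∀ ⦃Z : Aff C⦄ (p : Z ⟶ Y), S p → (affSheaf C).map p ≫ a = (affSheaf C).map p ≫ b) :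
    a = b := by
  apply ((zariskiTopology C).uliftYonedaEquiv).injective
  have hF := ((isSheaf_iff_isSheaf_of_type _ _).1 F.property).isSeparated S hS
  refine hF.ext fun Z p hp ↦ ?_
  rw [GrothendieckTopology.uliftYonedaEquiv_naturality,
    GrothendieckTopology.uliftYonedaEquiv_naturality]
  exact congrArg _ (h p hp)

lemma hom_ext_affSheaf {F G : Sh C} {a b : F ⟶ G}
    (h : ∀ (X : Aff C) (p : (affSheaf C).obj X ⟶ F), p ≫ a = p ≫ b) : a = b :=
  (zariskiTopology C).hom_ext_uliftYoneda h

lemma mono_of_affSheaf {F G : Sh C} (i : F ⟶ G)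
    (h : ∀ (X : Aff C) (a b : (affSheaf C).obj X ⟶ F), a ≫ i = b ≫ i → a = b) : Mono i :=
  ⟨fun a b w ↦ hom_ext_affSheaf fun X p ↦ h X _ _ (by rw [Category.assoc, w, Category.assoc])⟩

/-- The sieve of morphisms along which a morphism from an affine scheme lifts to some member of
a family of morphisms. -/
def liftSieve {I : Type*} {G : I → Sh C} {F : Sh C} (q : ∀ k, G k ⟶ F) {Y : Aff C}
    (s : (affSheaf C).obj Y ⟶ F) : Sieve Y where
  arrows _ a := ∃ (k : I) (t : _ ⟶ G k), t ≫ q k = (affSheaf C).map a ≫ s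
  downward_closed := by
    rintro Z Z' a ⟨k, t, ht⟩ b
    exact ⟨k, (affSheaf C).map b ≫ t, by rw [Category.assoc, ht, Functor.map_comp, Category.assoc]⟩

/-- A family of morphisms of sheaves is jointly epimorphic. -/
def JointlyEpi {I : Type*} {G : I → Sh C} {F : Sh C} (q : ∀ k, G k ⟶ F) : Prop :=
  ∀ ⦃H : Sh C⦄ (a b : F ⟶ H), (∀ k, q k ≫ a = q k ≫ b) → a = b

lemma epi_sigmaDesc_iff {I : Type v} {G : I → Sh C} {F : Sh C} (q : ∀ k, G k ⟶ F) :
    Epi (Limits.Sigma.desc q) ↔ JointlyEpi q := by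
  constructor
  · intro _ H a b h
    rw [← cancel_epi (Limits.Sigma.desc q)]
    exact Limits.Sigma.hom_ext _ _ fun k ↦ by simpa using h k
  · exact fun h ↦ ⟨fun a b w ↦ h a b fun k ↦ by
      simpa using congrArg (Limits.Sigma.ι G k ≫ ·) w⟩

/-- The subfunctor of the sections in the image of some member of a family of morphisms. -/
def imageSubfunctor {I : Type*} {G : I → Sh C} {F : Sh C} (q : ∀ k, G k ⟶ F) :
    Subfunctor F.obj where
  obj U := { s | ∃ (k : I) (t : (G k).obj.obj U), (q k).hom.app U t = s }
  map {U V} r := by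
    rintro _ ⟨k, t, rfl⟩
    exact ⟨k, (G k).obj.map r t, NatTrans.naturality_apply (q k).hom r t⟩

/-- If the family is jointly epimorphic, the inclusion of its image subsheaf is both mono and epi,
hence invertible. Every section then lies in the image locally. Conversely, maps that agree on local
lifts agree by separatedness. -/
lemma jointlyEpi_iff {I : Type*} {G : I → Sh C} {F : Sh C} (q : ∀ k, G k ⟶ F) :
    JointlyEpi q ↔ ∀ (Y : Aff C) (s : (affSheaf C).obj Y ⟶ F),
      liftSieve q s ∈ zariskiTopology C Y := by
  constructor
  · intro h Y s
    have hF := (isSheaf_iff_isSheaf_of_type _ _).1 F.property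
    let N := (imageSubfunctor q).sheafify (zariskiTopology C)
    let N' : Sh C := ⟨N.toFunctor, (isSheaf_iff_isSheaf_of_type _ _).2
      ((imageSubfunctor q).sheafify_isSheaf hF)⟩
    let i : N' ⟶ F := ⟨N.ι⟩
    have hi : Mono i := by
      have : Mono ((sheafToPresheaf _ _).map i) := inferInstanceAs (Mono N.ι)
      exact (sheafToPresheaf _ _).mono_of_mono_map this
    let r (k : I) : G k ⟶ N' := ⟨Subfunctor.lift (q k).hom (by
      rintro U _ ⟨t, rfl⟩
      exact (imageSubfunctor q).le_sheafify _ _ ⟨k, t, rfl⟩)⟩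
    have hr (k : I) : r k ≫ i = q k := by
      ext
      rfl
    have : Epi i := ⟨fun a b w ↦ h a b fun k ↦ by rw [← hr, Category.assoc, w, Category.assoc]⟩
    have : IsIso i := isIso_of_mono_of_epi i
    let x := (zariskiTopology C).uliftYonedaEquiv (s ≫ inv i)
    have hx : i.hom.app _ x = (zariskiTopology C).uliftYonedaEquiv s := by
      rw [← GrothendieckTopology.uliftYonedaEquiv_comp]
      simp
    refine (zariskiTopology C).superset_covering ?_ x.2
    rintro Z a ⟨k, t, ht⟩
    refine ⟨k, (zariskiTopology C).uliftYonedaEquiv.symm t, ?_⟩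
    rw [GrothendieckTopology.uliftYonedaEquiv_symm_naturality_right, ht, Equiv.symm_apply_eq,
      ← GrothendieckTopology.uliftYonedaEquiv_naturality, ← hx]
    rfl
  · intro h H a b w
    refine hom_ext_affSheaf fun Y s ↦ hom_ext_of_cover (h Y s) ?_
    rintro Z p ⟨k, t, ht⟩
    rw [← reassoc_of% ht, ← reassoc_of% ht, w]

end JointlyEpi

/-! ### Opens of affine schemes: base change and locality -/

section Opens

variable {C : Type u} [Category.{v} C] [MonoidalCategory C] [SymmetricCategory C]
  [HasCoequalizers C] [MonoidalClosed C] [HasFiniteLimits C] [(zariskiTopology C).Subcanonical]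

/-- The affine opens `U k` covering `F` are pulled back to `Y`. A section of `F'` lifts to one of
the pullbacks wherever its image in `F` lifts to `U k`. -/
lemma IsOpenOfAffine.of_isPullback {X Y : Aff C} {F F' : Sh C} {i : F ⟶ (affSheaf C).obj X}
    (hi : IsOpenOfAffine i) {p : Y ⟶ X} {r : F' ⟶ F} {i' : F' ⟶ (affSheaf C).obj Y}
    (sq : IsPullback r i' i ((affSheaf C).map p)) : IsOpenOfAffine i' := by
  obtain ⟨hm, I, U, o, q, ho, hq, he⟩ := hi
  have hm' : Mono i' := ⟨fun a b w ↦ sq.hom_ext (by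
    rw [← cancel_mono i, Category.assoc, Category.assoc, sq.w, reassoc_of% w]) w⟩
  have hw (k : I) : ((affSheaf C).map (pullback.fst (o k) p) ≫ q k) ≫ i =
      (affSheaf C).map (pullback.snd (o k) p) ≫ (affSheaf C).map p := by
    rw [Category.assoc, hq, ← Functor.map_comp, pullback.condition, Functor.map_comp]
  refine ⟨hm', I, fun k ↦ pullback (o k) p, fun k ↦ pullback.snd _ _,
    fun k ↦ sq.lift _ _ (hw k), fun k ↦ (ho k).of_isPullback
      (IsPullback.of_hasPullback (o k) p).flip, fun k ↦ sq.lift_snd _ _ _, ?_⟩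
  rw [epi_sigmaDesc_iff, jointlyEpi_iff] at he ⊢
  intro Z s
  refine (zariskiTopology C).superset_covering ?_ (he Z (s ≫ r))
  rintro Z' a ⟨k, t, ht⟩
  obtain ⟨t, rfl⟩ := (affSheaf C).map_surjective t
  obtain ⟨s', hs'⟩ := (affSheaf C).map_surjective (s ≫ i')
  have hts : t ≫ o k = (a ≫ s') ≫ p := by
    apply (affSheaf C).map_injective
    rw [Functor.map_comp, ← hq, reassoc_of% ht, sq.w, Functor.map_comp, Functor.map_comp, hs']
    simp only [Category.assoc]
  refine ⟨k, (affSheaf C).map (pullback.lift t (a ≫ s') hts), ?_⟩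
  rw [← cancel_mono i', Category.assoc, sq.lift_snd, ← Functor.map_comp, pullback.lift_snd,
    Functor.map_comp, hs', Category.assoc]

/-- Opens of `Y` are obtained by composing opens of the members of a finite Zariski covering with
the open immersions of that covering, and their family is still locally surjective onto `V`. -/
lemma isOpenOfAffine_of_cover {Y : Aff C} {V : Sh C} (j : V ⟶ (affSheaf C).obj Y) {S : Sieve Y}
    (hS : S ∈ zariskiTopology C Y)
    (h : ∀ ⦃Z : Aff C⦄ (a : Z ⟶ Y), S a → ∃ (W : Sh C) (r : W ⟶ V) (j' : W ⟶ (affSheaf C).obj Z),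
      IsPullback r j' j ((affSheaf C).map a) ∧ IsOpenOfAffine j') : IsOpenOfAffine j := by
  have hm : Mono j := mono_of_affSheaf j fun Z a b w ↦ by
    obtain ⟨c, hc⟩ := (affSheaf C).map_surjective (a ≫ j)
    refine hom_ext_of_cover ((zariskiTopology C).pullback_stable c hS) fun Z' z hz ↦ ?_
    obtain ⟨W, r, j', sq, hj'⟩ := h _ hz
    have := hj'.1
    have ha : ((affSheaf C).map z ≫ a) ≫ j = 𝟙 _ ≫ (affSheaf C).map (z ≫ c) := by
      rw [Category.assoc, ← hc, Category.id_comp, Functor.map_comp]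
    have hb : ((affSheaf C).map z ≫ b) ≫ j = 𝟙 _ ≫ (affSheaf C).map (z ≫ c) := by
      rw [Category.assoc, ← w, ← hc, Category.id_comp, Functor.map_comp]
    have e : sq.lift _ _ ha = sq.lift _ _ hb := by
      rw [← cancel_mono j', sq.lift_snd, sq.lift_snd]
    rw [← sq.lift_fst _ _ ha, e, sq.lift_fst]
  obtain ⟨n, X, p, ho, hc, hp⟩ := mem_zariskiTopology_iff.1 hS
  choose W r j' sq hj' using fun k ↦ h (p k) (hp k)
  choose I U o q hoo hq he using fun k ↦ (hj' k).2
  refine ⟨hm, Σ k, I k, fun x ↦ U x.1 x.2, fun x ↦ o x.1 x.2 ≫ p x.1, fun x ↦ q x.1 x.2 ≫ r x.1,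
    fun x ↦ (hoo x.1 x.2).comp (ho x.1), fun x ↦ ?_, ?_⟩
  · rw [Category.assoc, (sq x.1).w, ← Category.assoc, hq, Functor.map_comp]
  · rw [epi_sigmaDesc_iff, jointlyEpi_iff]
    intro Z s
    obtain ⟨c, hc'⟩ := (affSheaf C).map_surjective (s ≫ j)
    have hT : Sieve.generate (Presieve.ofArrows X p) ∈ zariskiTopology C Y :=
      mem_zariskiTopology_iff.2 ⟨n, X, p, ho, hc, fun k ↦ Sieve.le_generate (.ofArrows X p) _ _ ⟨k⟩⟩
    -- Locally on `Z` the section `s` lies over some `X k`, hence lifts to `W k`. There it is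
    -- locally in the image of one of the `q k l`.
    refine (zariskiTopology C).transitive ((zariskiTopology C).pullback_stable c hT) _ ?_
    rintro Z' z ⟨_, z₁, _, ⟨k⟩, hz⟩
    have hw : ((affSheaf C).map z ≫ s) ≫ j = (affSheaf C).map z₁ ≫ (affSheaf C).map (p k) := by
      rw [Category.assoc, ← hc', ← Functor.map_comp, ← Functor.map_comp, hz]
    have hk := he k
    rw [epi_sigmaDesc_iff, jointlyEpi_iff] at hk
    refine (zariskiTopology C).superset_covering ?_ (hk Z' ((sq k).lift _ _ hw))
    rintro Z'' w ⟨l, t, ht⟩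
    refine ⟨⟨k, l⟩, t, ?_⟩
    rw [reassoc_of% ht, (sq k).lift_fst, Functor.map_comp, Category.assoc]

end Opens

/-! ### Exactness of `shriek` and its values on affine schemes -/

section Shriek

variable {C D : Type u} [Category.{v} C] [MonoidalCategory C] [SymmetricCategory C]
  [Category.{v} D] [MonoidalCategory D] [SymmetricCategory D]
  {f : C ⥤ D} [f.Braided] {g : D ⥤ C} (adj : f ⊣ g)
  [HasCoequalizers C] [MonoidalClosed C] [HasCoequalizers D] [MonoidalClosed D]

/-- The functor `g : Aff_D ⥤ Aff_C` is left adjoint to `f : Aff_C ⥤ Aff_D`. -/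
def affAdj : affRight adj ⊣ affLeft f := (commAdj adj).op

/-- The functor `shriek` is left adjoint to precomposition with `f : Aff_C ⥤ Aff_D`. -/
def shriekAdj [(affLeft f).IsContinuous (zariskiTopology C) (zariskiTopology D)] :
    shriek adj ⊣ (affLeft f).sheafPushforwardContinuous (Type (max u v)) (zariskiTopology C)
      (zariskiTopology D) :=
  (((affAdj adj).op.whiskerLeft (Type (max u v))).comp
    (sheafificationAdjunction (zariskiTopology D) (Type (max u v)))).restrictFullyFaithful
      (fullyFaithfulSheafToPresheaf _ _) (Functor.FullyFaithful.id _) (Iso.refl _) (Iso.refl _)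

/-- Left adjoints preserve jointly epimorphic families, by transposition. -/
lemma JointlyEpi.shriek [(affLeft f).IsContinuous (zariskiTopology C) (zariskiTopology D)]
    {I : Type*} {G : I → Sh C} {F : Sh C} {q : ∀ k, G k ⟶ F} (h : JointlyEpi q) :
    JointlyEpi (fun k ↦ (shriek adj).map (q k)) := by
  intro H a b w
  apply ((shriekAdj adj).homEquiv _ _).injective
  refine h _ _ fun k ↦ ?_
  rw [← Adjunction.homEquiv_naturality_left, ← Adjunction.homEquiv_naturality_left, w]

/-- The inclusion of sheaves and precomposition with `g` preserve limits, and sheafification is left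
exact. -/
instance : PreservesFiniteLimits (shriek adj) := by
  have : PreservesFiniteLimits (sheafToPresheaf (zariskiTopology C) (Type (max u v))) :=
    inferInstance
  have : PreservesFiniteLimits (presheafToSheaf (zariskiTopology D) (Type (max u v))) :=
    inferInstance
  have : PreservesFiniteLimits ((Functor.whiskeringLeft _ _ (Type (max u v))).obj
    (affRight adj).op) := inferInstance
  exact inferInstanceAs (PreservesFiniteLimits (sheafToPresheaf _ _ ⋙
    (Functor.whiskeringLeft _ _ _).obj (affRight adj).op ⋙ presheafToSheaf _ _))

variable [(zariskiTopology C).Subcanonical] [(zariskiTopology D).Subcanonical]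

/-- The presheaf `h_X ∘ g` is represented by `f(X)`. -/
def yonedaRightIso : affSheaf C ⋙ sheafToPresheaf _ _ ⋙
    (Functor.whiskeringLeft _ _ _).obj (affRight adj).op ≅
      affLeft f ⋙ affSheaf D ⋙ sheafToPresheaf _ _ :=
  NatIso.ofComponents (fun X ↦ NatIso.ofComponents (fun Z ↦
    (Equiv.ulift.trans (((affAdj adj).homEquiv Z.unop X).trans Equiv.ulift.symm)).toIso)
    (fun r ↦ by
      ext ⟨t⟩
      refine ULift.ext _ _ ?_
      exact (affAdj adj).homEquiv_naturality_left r.unop t))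
    (fun p ↦ by
      ext Z ⟨t⟩
      refine ULift.ext _ _ ?_
      exact (affAdj adj).homEquiv_naturality_right t p)

/-- The functor `shriek` extends `f : Aff_C ⥤ Aff_D`. -/
def shriekAffIso : affSheaf C ⋙ shriek adj ≅ affLeft f ⋙ affSheaf D :=
  Functor.isoWhiskerRight (yonedaRightIso adj) (presheafToSheaf _ _) ≪≫
    Functor.isoWhiskerLeft (affLeft f ⋙ affSheaf D)
      (asIso (sheafificationAdjunction (zariskiTopology D) (Type (max u v))).counit) ≪≫
    Functor.rightUnitor _

/-- Sections of `shriek F` locally come from sections of `F`. -/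
lemma exists_local_lift {F : Sh C} {Y : Aff D} (y : (affSheaf D).obj Y ⟶ (shriek adj).obj F) :
    ∃ S ∈ zariskiTopology D Y, ∀ ⦃Z : Aff D⦄ (a : Z ⟶ Y), S a →
      ∃ (X : Aff C) (e : (affSheaf D).obj Z ⟶ (shriek adj).obj ((affSheaf C).obj X))
        (x : (affSheaf C).obj X ⟶ F), (affSheaf D).map a ≫ y = e ≫ (shriek adj).map x := by
  let η (F : Sh C) := toSheafify (zariskiTopology D) ((affRight adj).op ⋙ F.obj)
  have hη : Presheaf.IsLocallySurjective (zariskiTopology D) (η F) := inferInstance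
  let y' : ((shriek adj).obj F).obj.obj (Opposite.op Y) :=
    (zariskiTopology D).uliftYonedaEquiv y
  refine ⟨_, hη.imageSieve_mem y', ?_⟩
  rintro Z a ⟨t, ht⟩
  -- A section of `F ∘ g` over `Z` is a point of `F` with values in the affine scheme `g(Z)`, and it
  -- is the image under `x` of the identity of `g(Z)`. The class `e` of this identity gives the
  -- factorization.
  let x : (affSheaf C).obj ((affRight adj).obj Z) ⟶ F := (zariskiTopology C).uliftYonedaEquiv.symm t
  have hx : x.hom.app (Opposite.op ((affRight adj).obj Z)) ⟨𝟙 _⟩ = t :=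
    (zariskiTopology C).uliftYonedaEquiv.apply_symm_apply t
  let e : ((shriek adj).obj ((affSheaf C).obj ((affRight adj).obj Z))).obj.obj (Opposite.op Z) :=
    (η ((affSheaf C).obj ((affRight adj).obj Z))).app (Opposite.op Z) ⟨𝟙 _⟩
  refine ⟨(affRight adj).obj Z, (zariskiTopology D).uliftYonedaEquiv.symm e, x, ?_⟩
  rw [GrothendieckTopology.uliftYonedaEquiv_symm_naturality_right, Equiv.eq_symm_apply,
    ← GrothendieckTopology.uliftYonedaEquiv_naturality]
  refine ht.symm.trans ?_
  have n := toSheafify_naturality (zariskiTopology D) (Functor.whiskerLeft (affRight adj).op x.hom)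
  have n' := ConcreteCategory.congr_hom (NatTrans.congr_app n (Opposite.op Z)) ⟨𝟙 _⟩
  exact (congrArg ((η F).app (Opposite.op Z)) hx.symm).trans n'

end Shriek

/-! ### Preservation of opens, open immersions and schemes -/

section Schemes

variable {C D : Type u}
  [Category.{v} C] [MonoidalCategory C] [SymmetricCategory C] [MonoidalClosed C]
  [HasFiniteLimits C] [HasColimits C]
  [Category.{v} D] [MonoidalCategory D] [SymmetricCategory D] [MonoidalClosed D]
  [HasFiniteLimits D] [HasColimits D]
  {f : C ⥤ D} [f.Braided] {g : D ⥤ C} {adj : f ⊣ g} [g.ReflectsIsomorphisms]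
  [PreservesFilteredColimitsOfSize.{v, v} g]

/-- The isomorphism between `shriek` of an affine scheme and an affine scheme. -/
abbrev shriekAff (adj : f ⊣ g) (X : Aff C) :
    (shriek adj).obj ((affSheaf C).obj X) ≅ (affSheaf D).obj ((affLeft f).obj X) :=
  (shriekAffIso adj).app X

lemma shriekAff_naturality {X Y : Aff C} (p : X ⟶ Y) :
    (shriek adj).map ((affSheaf C).map p) ≫ (shriekAff adj Y).hom =
      (shriekAff adj X).hom ≫ (affSheaf D).map ((affLeft f).map p) :=
  (shriekAffIso adj).hom.naturality p

/-- Isomorphisms in the source do not change whether a family is jointly epimorphic. -/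
lemma JointlyEpi.iso_comp {I : Type*} {G G' : I → Sh D} {F : Sh D} {q : ∀ k, G k ⟶ F}
    (h : JointlyEpi q) (e : ∀ k, G' k ≅ G k) : JointlyEpi (fun k ↦ (e k).hom ≫ q k) :=
  fun H a b w ↦ h a b fun k ↦ by
    rw [← cancel_epi (e k).hom, ← Category.assoc, w, Category.assoc]

lemma IsOpenOfAffine.shriek (hbc : FlatBaseChange adj) {X : Aff C} {F : Sh C}
    {i : F ⟶ (affSheaf C).obj X} (hi : IsOpenOfAffine i) :
    IsOpenOfAffine ((shriek adj).map i ≫ (shriekAff adj X).hom) := by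
  have := isContinuous_affLeft hbc
  obtain ⟨hm, I, U, p, q, ho, hq, he⟩ := hi
  refine ⟨inferInstance, I, fun k ↦ (affLeft f).obj (U k), fun k ↦ (affLeft f).map (p k),
    fun k ↦ (shriekAff adj (U k)).inv ≫ (RelSch.shriek adj).map (q k),
    fun k ↦ (ho k).affLeft hbc, fun k ↦ ?_, ?_⟩
  · rw [Category.assoc, ← Functor.map_comp_assoc, hq, shriekAff_naturality, Iso.inv_hom_id_assoc]
  · rw [epi_sigmaDesc_iff] at he ⊢
    exact (he.shriek adj).iso_comp fun k ↦ (shriekAff adj (U k)).symm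

/-- On a covering of `Y`, the point `y` factors through the image of a point `x` of `F` with affine
source `T`. There the fibre product is a base change of the image of the open `pullback.snd p x` of
`T`, by left exactness, and locality on `Y` concludes. -/
lemma IsOpenImmersion.shriek (hbc : FlatBaseChange adj) {X : Aff C} {F : Sh C}
    {p : (affSheaf C).obj X ⟶ F} (hp : IsOpenImmersion p) :
    IsOpenImmersion ((shriekAff adj X).inv ≫ (shriek adj).map p) := by
  intro Y y
  obtain ⟨S, hS, h⟩ := exists_local_lift adj y
  refine isOpenOfAffine_of_cover _ hS fun Z a ha ↦ ?_
  obtain ⟨T, e, x, hx⟩ := h a ha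
  obtain ⟨t, ht⟩ := (affSheaf D).map_surjective (e ≫ (shriekAff adj T).hom)
  have hopen := (hp T x).shriek hbc
  have sq₁ := (IsPullback.of_hasPullback p x).map (RelSch.shriek adj)
  have sq₂ : IsPullback ((RelSch.shriek adj).map (pullback.fst p x) ≫ (shriekAff adj X).hom)
      ((RelSch.shriek adj).map (pullback.snd p x) ≫ (shriekAff adj T).hom)
      ((shriekAff adj X).inv ≫ (RelSch.shriek adj).map p)
      ((shriekAff adj T).inv ≫ (RelSch.shriek adj).map x) :=
    sq₁.of_iso (Iso.refl _) (shriekAff adj X) (shriekAff adj T) (Iso.refl _)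
      (by simp) (by simp) (by simp) (by simp)
  have sq₃ := IsPullback.of_hasPullback
    ((RelSch.shriek adj).map (pullback.snd p x) ≫ (shriekAff adj T).hom) ((affSheaf D).map t)
  -- The pasted square is the fibre product along `a ≫ y`. It therefore factors through the fibre
  -- product along `y`, which leaves a pullback square over `a`.
  have sq₄ := sq₃.flip.paste_vert sq₂.flip
  have hy : (affSheaf D).map t ≫ (shriekAff adj T).inv ≫ (RelSch.shriek adj).map x =
      (affSheaf D).map a ≫ y := by
    rw [ht, Category.assoc, Iso.hom_inv_id_assoc, hx]
  rw [hy] at sq₄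
  refine ⟨_, _, _, (IsPullback.of_bot' sq₄ (IsPullback.of_hasPullback _ y).flip).flip,
    hopen.of_isPullback sq₃⟩

lemma isScheme_shriek (hbc : FlatBaseChange adj) {F : Sh C} (hF : isScheme C F) :
    isScheme D ((shriek adj).obj F) := by
  have := isContinuous_affLeft hbc
  obtain ⟨I, X, p, he, hp⟩ := hF
  refine ⟨I, fun k ↦ (affLeft f).obj (X k),
    fun k ↦ (shriekAff adj (X k)).inv ≫ (shriek adj).map (p k), ?_, fun k ↦ (hp k).shriek hbc⟩
  rw [epi_sigmaDesc_iff] at he ⊢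
  exact (he.shriek adj).iso_comp fun k ↦ (shriekAff adj (X k)).symm

end Schemes

end

end RelSch

/-! ### Assembly of the three statements -/

theorem mainTheorem4
    {C D : Type u}
    [Category.{v} C] [MonoidalCategory C] [SymmetricCategory C] [MonoidalClosed C]
    [HasLimits C] [HasColimits C]
    [Category.{v} D] [MonoidalCategory D] [SymmetricCategory D] [MonoidalClosed D]
    [HasLimits D] [HasColimits D]
    (f : C ⥤ D) [f.Braided] (g : D ⥤ C) (adj : f ⊣ g)
    (hg : g.ReflectsIsomorphisms)
    (hgf : PreservesFilteredColimitsOfSize.{v, v} g)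
    (hbc : ∀ (A B : CommMon C) (φ : A ⟶ B), RelSch.IsFlat φ →
      ∀ N : RelSch.ModCat (f.mapCommMon.obj A), IsIso (RelSch.baseChangeMap adj φ N)) :
    (RelSch.affLeft f).IsContinuous (RelSch.zariskiTopology C) (RelSch.zariskiTopology D) ∧
    ∃ (_ : (RelSch.zariskiTopology C).Subcanonical) (_ : (RelSch.zariskiTopology D).Subcanonical),
      (∀ X : RelSch.Sh C, RelSch.isScheme C X →
        RelSch.isScheme D ((RelSch.shriek adj).obj X)) ∧
      (∃ Φ : RelSch.Sch C ⥤ RelSch.Sch D,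
        Nonempty (Φ ⋙ (RelSch.isScheme D).ι ≅ (RelSch.isScheme C).ι ⋙ RelSch.shriek adj)) ∧
      Nonempty (RelSch.affSheaf C ⋙ RelSch.shriek adj ≅
        RelSch.affLeft f ⋙ RelSch.affSheaf D) := by
  have h : RelSch.FlatBaseChange adj := hbc
  refine ⟨RelSch.isContinuous_affLeft h, inferInstance, inferInstance,
    fun X hX ↦ RelSch.isScheme_shriek h hX,
    ⟨(RelSch.isScheme D).lift ((RelSch.isScheme C).ι ⋙ RelSch.shriek adj)
      fun X ↦ RelSch.isScheme_shriek h X.property,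
      ⟨(RelSch.isScheme D).liftCompιIso _ _⟩⟩, ⟨RelSch.shriekAffIso adj⟩⟩
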